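/- **Setting.** Let $n\in\{2,3\}$. A *hierarchical parametric mesh* of $(0,1)^n$ is given by nested Cartesian grids of breakpoints of levels $\ell=0,1,\dots,L$ on $[0,1]^n$ and by sets $(0,1)^n=\hat\Omega^0\supseteq\hat\Omega^1\supseteq\dots\supseteq\hat\Omega^L=\emptyset$, where $\hat\Omega^{\ell+1}$ is the interior of a union of closed cells of level $\ell$; its elements $\hat K\in\hat{\mathcal Q}$ are the open cells of level $\ell$ contained in $\hat\Omega^\ell$ but not in $\hat\Omega^{\ell+1}$, for $0\le \ell<L$. Let $\mathbf F:(0,1)^n\to\mathbb R^n$ be bi-Lipschitz with constant $\Lambda$, that is $\Lambda^{-1}|x-y|\le|\mathbf F(x)-\mathbf F(y)|\le\Lambda|x-y|$, with its continuous extension to $[0,1]^n$ still written $\mathbf F$, and suppose that $\mathbf F$ is $C^\infty$ on $\overline{\hat K}$ and $\mathbf F^{-1}$ is $C^\infty$ on $\overline{\mathbf F(\hat K)}$ for every $\hat K\in\hat{\mathcal Q}$. Put $\Omega_0=\mathbf F((0,1)^n)$ and $\mathcal Q=\{\mathbf F(\hat K):\hat K\in\hat{\mathcal Q}\}$, and let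 $\mathcal F$ be the set of the faces of $\mathcal Q$, i.e. of the images under $\mathbf F$ of the relatively open $(n-1)$-dimensional sides of the cells $\hat K\in\hat{\mathcal Q}$. For $\omega=K\in\mathcal Q$ or $\omega=F\in\mathcal F$, let $h_\omega=\sup_{x,y\in\omega}\rho(x,y)$, where $\rho(x,y)$ is the infimum of the lengths of continuous piecewise $C^1$ paths in $\omega$ from $x$ to $y$. Assume that $\mathcal Q$ is shape regular with constant $\sigma$: $h_K\le\sigma\rho_K$ for all $K\in\mathcal Q$, where $\rho_K$ is the radius of the largest ball inscribed in $K$. Let $D_1,\dots,D_s\subset\mathbb R^n$ be bounded open connected non-empty sets, $D=\mathrm{int}\big(\bigcup_i\overline{D_i}\big)$ and $\Omega=\Omega_0\setminus\overline D$, and let $\Gamma_N\subset\partial\Omega$ be relatively open in $\partial\Omega$. A face $F\in\mathcal F$ is a *cut face* if $F\cap\Gamma_N\ne F$; put $F_N=F\cap\Gamma_N$. For $S\subset F$ let $|S|$ be the $(n-1)$-dimensional (surface) measure of $S$ and $\|\cdot\|_{0,S}$ the norm of $L^2(S)$. Let $H^{1/2}(F)$ be the space of $v\in L^2(F)$ with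 $$|v|_{\frac12,F}^2=\int_F\int_F\frac{|v(x)-v(y)|^2}{|x-y|^{n}}\,\mathrm ds(x)\,\mathrm ds(y)<\infty .$$ Let $\eta>0$ be the unique solution of $\eta=-\log\eta$, and let $c_S=\max(-\log|S|,\eta)^{1/2}$ if $n=2$ and $c_S=1$ if $n=3$. For a cut face $F$, let $\delta_F=c_{F_N}|F_N|^{\frac1{2(n-1)}}$; here and below $c_{F_N}|F_N|^{\frac1{2(n-1)}}$ is read as $0$ if $|F_N|=0$. **Lemma.** There is a constant $C>0$, depending only on $n$, $\Lambda$ and $\sigma$, such that in the above setting, for every cut face $F$ with $F_N\neq\emptyset$ and every $v\in H^{1/2}(F)$, $$\|v\|_{0,F_N}\le C\,c_{F_N}|F_N|^{\frac1{2(n-1)}}\Big(h_F^{-1}\|v\|_{0,F}^2+|v|_{\frac12,F}^2\Big)^{\frac12}=C\,\delta_F\Big(h_F^{-1}\|v\|_{0,F}^2+|v|_{\frac12,F}^2\Big)^{\frac12}.$$ In particular $C$ does not depend on the measures of $F_N$ and $F$, on the mesh size, on the number of levels $L$, on the sets $D_i$, or on $\Gamma_N$. -/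

import Mathlib

open Set MeasureTheory
open scoped ENNReal Topology ContDiff

namespace TrimmedIGA

/-- Euclidean space `ℝⁿ`, with the Euclidean norm. -/
abbrev E (n : ℕ) : Type := EuclideanSpace ℝ (Fin n)

/-! ### Boxes and hierarchical meshes of the parametric cube -/

/-- The open parametric cube `(0,1)ⁿ`. -/
def openCube (n : ℕ) : Set (E n) := {x | ∀ i, x i ∈ Ioo (0 : ℝ) 1}

/-- The closed cube `[0,1]ⁿ`. -/
def closedCube (n : ℕ) : Set (E n) := {x | ∀ i, x i ∈ Icc (0 : ℝ) 1}

/-- The open box `∏ᵢ (aᵢ, bᵢ)`. -/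
def openBox {n : ℕ} (a b : E n) : Set (E n) := {x | ∀ i, x i ∈ Ioo (a i) (b i)}

/-- The open `(n-1)`-dimensional side `{x_j = c} ∩ ∏_{i ≠ j} (aᵢ, bᵢ)` of a box. -/
def boxSide {n : ℕ} (a b : E n) (j : Fin n) (c : ℝ) : Set (E n) :=
  {x | x j = c ∧ ∀ i, i ≠ j → x i ∈ Ioo (a i) (b i)}

/-- `a` and `b` are the lower and the upper corner of a cell of the Cartesian grid with
breakpoints `Z i` in direction `i`: in each direction, `a i < b i` are consecutive breakpoints. -/
def IsGridCell {n : ℕ} (Z : Fin n → Finset ℝ) (a b : E n) : Prop :=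
  ∀ i, a i ∈ Z i ∧ b i ∈ Z i ∧ a i < b i ∧ ∀ z ∈ Z i, z ≤ a i ∨ b i ≤ z

/-- The (open) cells of the Cartesian grid with breakpoints `Z`. -/
def gridCells {n : ℕ} (Z : Fin n → Finset ℝ) : Set (Set (E n)) :=
  {K | ∃ a b, IsGridCell Z a b ∧ K = openBox a b}

/-- The data behind a hierarchical mesh of `(0,1)ⁿ`: nested Cartesian grids of breakpoints (the
parametric Bézier meshes of nested tensor-product spline spaces) and a decreasing hierarchy of
subdomains `(0,1)ⁿ = Ω̂⁰ ⊇ Ω̂¹ ⊇ ⋯ ⊇ Ω̂ᴸ = ∅`, in which `Ω̂ˡ⁺¹` is the interior of a union of closed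
cells of level `l`. -/
structure Hierarchy (n : ℕ) where
  /-- the depth -/
  L : ℕ
  /-- the breakpoints of level `l` in direction `i` -/
  grid : ℕ → Fin n → Finset ℝ
  grid_subset : ∀ l i, ∀ z ∈ grid l i, z ∈ Icc (0 : ℝ) 1
  zero_mem : ∀ l i, (0 : ℝ) ∈ grid l i
  one_mem : ∀ l i, (1 : ℝ) ∈ grid l i
  grid_nested : ∀ l < L, ∀ i, grid l i ⊆ grid (l + 1) i
  /-- the subdomain of level `l` -/
  dom : ℕ → Set (E n)
  dom_zero : dom 0 = openCube n
  dom_last : dom L = ∅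
  dom_nested : ∀ l < L, dom (l + 1) ⊆ dom l
  dom_succ : ∀ l < L, ∃ S ⊆ gridCells (grid l), dom (l + 1) = interior (⋃ K ∈ S, closure K)

/-- The box with corners `a`, `b` is an active cell: for some level `l` it is a cell of level `l`
contained in `Ω̂ˡ` but not in `Ω̂ˡ⁺¹`. (As `Ω̂ᴸ = ∅`, the level `L` contributes no cell.) -/
def Hierarchy.IsActive {n : ℕ} (M : Hierarchy n) (a b : E n) : Prop :=
  ∃ l < M.L, IsGridCell (M.grid l) a b ∧ openBox a b ⊆ M.dom l ∧ ¬ openBox a b ⊆ M.dom (l + 1)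

/-- The parametric hierarchical mesh: the set of the active cells. -/
def Hierarchy.parametricMesh {n : ℕ} (M : Hierarchy n) : Set (Set (E n)) :=
  {K | ∃ a b, M.IsActive a b ∧ K = openBox a b}

/-- The physical hierarchical mesh: the images of the active cells under `Φ`. -/
def Hierarchy.mesh {n : ℕ} (M : Hierarchy n) (Φ : E n → E n) : Set (Set (E n)) :=
  {K | ∃ K' ∈ M.parametricMesh, K = Φ '' K'}

/-- The faces (edges, if `n = 2`) of the physical mesh: the images under `Φ` of the sides of the
active cells. -/
def Hierarchy.faces {n : ℕ} (M : Hierarchy n) (Φ : E n → E n) : Set (Set (E n)) :=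
  {F | ∃ a b, M.IsActive a b ∧ ∃ j c, (c = a j ∨ c = b j) ∧ F = Φ '' boxSide a b j c}

/-- The regularity assumption on the parametrization: it is bi-Lipschitz with constant `Λ`, and it
and its inverse are smooth up to the boundary on each element. A bi-Lipschitz map of the open cube
extends uniquely to a bi-Lipschitz map of the closed cube with the same constant, and `Φ` stands
for that extension. -/
structure IsRegularParam {n : ℕ} (M : Hierarchy n) (Λ : ℝ) (Φ : E n → E n) : Prop where
  le_mul_dist : ∀ x ∈ closedCube n, ∀ y ∈ closedCube n, dist (Φ x) (Φ y) ≤ Λ * dist x y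
  dist_le_mul : ∀ x ∈ closedCube n, ∀ y ∈ closedCube n, dist x y ≤ Λ * dist (Φ x) (Φ y)
  smooth : ∀ K ∈ M.parametricMesh, ContDiffOn ℝ ∞ Φ (closure K)
  smooth_inv : ∀ K ∈ M.mesh Φ, ContDiffOn ℝ ∞ (Function.invFunOn Φ (closedCube n)) (closure K)

/-! ### Diameters and shape regularity -/

/-- `γ`, restricted to `[0,1]`, is a continuous piecewise `C¹` path in `W` from `x` to `y`: off a
finite set `S` of break points it is `C¹`, up to the end points of each piece. -/
structure IsPiecewiseC1Path {n : ℕ} (W : Set (E n)) (x y : E n) (γ : ℝ → E n) : Prop where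
  continuousOn : ContinuousOn γ (Icc 0 1)
  piecewise : ∃ S : Finset ℝ, ∀ s t : ℝ, 0 ≤ s → s < t → t ≤ 1 → (∀ z ∈ S, z ∉ Ioo s t) →
    ContDiffOn ℝ 1 γ (Icc s t)
  source : γ 0 = x
  target : γ 1 = y
  mem : ∀ t ∈ Icc (0 : ℝ) 1, γ t ∈ W

/-- The infimum of the lengths of continuous piecewise `C¹` paths in `W` between `x` and `y`. The
length of a path is its total variation. -/
noncomputable def pathDist {n : ℕ} (W : Set (E n)) (x y : E n) : ℝ≥0∞ :=
  ⨅ (γ : ℝ → E n) (_ : IsPiecewiseC1Path W x y γ), eVariationOn γ (Icc 0 1)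

/-- The diameter of `W` with respect to `pathDist`. -/
noncomputable def pathDiam {n : ℕ} (W : Set (E n)) : ℝ :=
  (⨆ x ∈ W, ⨆ y ∈ W, pathDist W x y).toReal

/-- The radius of the largest ball inscribed in `K`. -/
noncomputable def inradius {n : ℕ} (K : Set (E n)) : ℝ :=
  sSup {r : ℝ | ∃ x, Metric.ball x r ⊆ K}

/-- Shape regularity with constant `σ`: `h_K ≤ σ ρ_K` for each element `K`. -/
def IsShapeRegular {n : ℕ} (σ : ℝ) (Q : Set (Set (E n))) : Prop :=
  ∀ K ∈ Q, pathDiam K ≤ σ * inradius K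

/-! ### The trimmed domain and the Neumann boundary -/

/-- The trimmed domain `Ω₀ \ closure D`, where `Ω₀ = Φ((0,1)ⁿ)` and `D` is the interior of the union
of the closures of the `Dᵢ`. -/
def trimmedDomain {n s : ℕ} (Φ : E n → E n) (D : Fin s → Set (E n)) : Set (E n) :=
  Φ '' openCube n \ closure (interior (⋃ i, closure (D i)))

/-- `Γ` is a (relatively) open subset of the boundary of `Ω`. -/
def IsOpenInBoundary {n : ℕ} (Ω Γ : Set (E n)) : Prop :=
  ∃ U : Set (E n), IsOpen U ∧ Γ = U ∩ frontier Ω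

/-- The cut faces: the faces that are not contained in `Γ_N`. -/
def cutFaces {n : ℕ} (𝓕 : Set (Set (E n))) (ΓN : Set (E n)) : Set (Set (E n)) :=
  {F ∈ 𝓕 | F ∩ ΓN ≠ F}

/-! ### Surface measure and the space `H^{1/2}` of an `(n-1)`-dimensional set -/

/-- The surface measure on `S ⊆ ℝⁿ`: the `(n-1)`-dimensional Hausdorff measure, normalized to agree
with Lebesgue measure on `ℝⁿ⁻¹`. -/
noncomputable def surf {n : ℕ} (S : Set (E n)) : Measure (E n) :=
  (μHE[n - 1] : Measure (E n)).restrict S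

/-- The `(n-1)`-dimensional measure `|S|`. -/
noncomputable def area {n : ℕ} (S : Set (E n)) : ℝ := ((μHE[n - 1] : Measure (E n)) S).toReal

/-- The norm `‖v‖_{0,S}` of `L²(S)`. -/
noncomputable def normL2 {n : ℕ} (v : E n → ℝ) (S : Set (E n)) : ℝ :=
  (eLpNorm v 2 (surf S)).toReal

/-- The square of the Sobolev-Slobodeckij seminorm of order `1/2` on an `(n-1)`-dimensional set:
`∫_S ∫_S |v(x) - v(y)|² / |x - y|^{(n-1) + 2·(1/2)}`. -/
noncomputable def eSeminormHalfSq {n : ℕ} (v : E n → ℝ) (S : Set (E n)) : ℝ≥0∞ :=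
  ∫⁻ x, ∫⁻ y, edist (v x) (v y) ^ 2 / edist x y ^ n ∂(surf S) ∂(surf S)

/-- The seminorm `|v|_{1/2,S}`. -/
noncomputable def seminormHalf {n : ℕ} (v : E n → ℝ) (S : Set (E n)) : ℝ :=
  √(eSeminormHalfSq v S).toReal

/-- `v ∈ H^{1/2}(S)`. -/
def MemHHalf {n : ℕ} (v : E n → ℝ) (S : Set (E n)) : Prop :=
  MemLp v 2 (surf S) ∧ eSeminormHalfSq v S ≠ ⊤

/-! ### The weights -/

theorem existsUnique_eta : ∃! η : ℝ, 0 < η ∧ η = -Real.log η := by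
  have hc : ContinuousOn (fun x : ℝ => x + Real.log x) (Icc (Real.exp (-1)) 1) := by
    refine continuousOn_id.add (Real.continuousOn_log.mono ?_)
    intro x hx
    exact ((Real.exp_pos _).trans_le hx.1).ne'
  have h1 : Real.exp (-1) ≤ 1 := Real.exp_le_one_iff.2 (by norm_num)
  have h0 : (0 : ℝ) ∈ Icc (Real.exp (-1) + Real.log (Real.exp (-1))) (1 + Real.log 1) := by
    rw [Real.log_exp, Real.log_one]
    constructor <;> linarith
  obtain ⟨η, hη, hz⟩ := intermediate_value_Icc h1 hc h0
  have hpos : 0 < η := (Real.exp_pos _).trans_le hη.1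
  simp only at hz
  refine ⟨η, ⟨hpos, by linarith⟩, ?_⟩
  rintro y ⟨hy, hy'⟩
  rcases lt_trichotomy y η with h | h | h
  · have := Real.log_lt_log hy h
    linarith
  · exact h
  · have := Real.log_lt_log hpos h
    linarith

/-- The unique `η > 0` with `η = -log η`. -/
noncomputable def eta : ℝ := existsUnique_eta.choose

/-- The constant `c_S`: `max(-log |S|, η)^{1/2}` if `n = 2`, and `1` otherwise (that is, for
`n = 3`). -/
noncomputable def logConst {n : ℕ} (S : Set (E n)) : ℝ :=
  if n = 2 then √(max (-Real.log (area S)) eta) else 1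

open Classical in
/-- The weight `δ_F`: `h_F^{1/2}` if `F ⊆ Γ_N`, and `c_{F ∩ Γ_N} |F ∩ Γ_N|^{1/(2(n-1))}` if `F` is a
cut face. -/
noncomputable def delta {n : ℕ} (ΓN F : Set (E n)) : ℝ :=
  if F ⊆ ΓN then √(pathDiam F)
  else logConst (F ∩ ΓN) * area (F ∩ ΓN) ^ (1 / (2 * ((n : ℝ) - 1)))

end TrimmedIGA

open TrimmedIGA

namespace TrimmedIGA

/-! ### Averages over balls -/

/-! Write `e = n - 2` and let `l` be the longest edge of a parametric cell. Shape regularity and the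
bi-Lipschitz bound make every side of that cell comparable to `l`, so its faces have `h_F ≲ l` and
are lower Ahlfors regular: balls of radius `ρ ≤ l` centred on the face have measure at least `c ρ ^
(e + 1)` (`exists_face_constants`).

For `x ∈ F`, compare `v x` with its averages `m k` over the balls of radius `l / 2 ^ k`. The
distance from `v x` to `m N` costs `l / 2 ^ N` times the inner Slobodeckij integral at `x`. The
telescoping sum `m 0 - m N` is handled by Cauchy–Schwarz with weights `(2 ^ k / l) ^ e`: the
weighted squares add up to at most the full seminorm, uniformly in `x` and `N`, and `m 0` is
controlled by the `L²` norm. Integration over `S = F_N` (`setLIntegral_sq_le_of_ball`) bounds `‖v‖²`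
on `S` by the squared `H^{1/2}` norm times `l / 2 ^ N + |S| (∑ (2 ^ k / l) ^ e + 1 / l ^ e)`.

It remains to choose `N` (`exists_weight_constant`). For `n = 2` the sum is `N`, and `2 ^ N ≈ 1 /
|S|` gives `|S|` times a logarithm. For `n = 3` the sum is about `2 ^ N / l`, and `2 ^ N ≈ l / √|S|`
gives `√|S|`; if `|S| > l ^ 2`, the bound by the norm on all of `F` suffices. -/

theorem enorm_average_sub_sq_le {α : Type*} [MeasurableSpace α] {ν : Measure α}
    [IsFiniteMeasure ν] (hν : ν univ ≠ 0) {f : α → ℝ} (hf : Integrable f ν) (c : ℝ) :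
    ‖(⨍ x, f x ∂ν) - c‖ₑ ^ 2 ≤ (ν univ)⁻¹ * ∫⁻ x, ‖f x - c‖ₑ ^ 2 ∂ν := by
  have : NeZero ν := ⟨fun h => hν (by simp [h])⟩
  -- For the normalized measure the claim is the comparison of the `L¹` and `L²` norms on a
  -- probability space.
  set ν' : Measure α := (ν univ)⁻¹ • ν with hν'
  have hp : IsProbabilityMeasure ν' := isProbabilityMeasureSMul
  have hf' : Integrable f ν' := hf.smul_measure (by simp [hν])
  have h1 : (⨍ x, f x ∂ν) - c = ∫ x, (f x - c) ∂ν' := by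
    rw [integral_sub hf' (integrable_const c)]
    simp [hν', average]
  have hm : AEStronglyMeasurable (fun x => f x - c) ν' :=
    hf'.aestronglyMeasurable.sub aestronglyMeasurable_const
  have h2 : ‖∫ x, (f x - c) ∂ν'‖ₑ ≤ eLpNorm (fun x => f x - c) 2 ν' := by
    refine (enorm_integral_le_lintegral_enorm _).trans ?_
    rw [← eLpNorm_one_eq_lintegral_enorm]
    exact eLpNorm_le_eLpNorm_of_exponent_le (by norm_num) hm
  have h3 : eLpNorm (fun x => f x - c) 2 ν' ^ 2 = ∫⁻ x, ‖f x - c‖ₑ ^ 2 ∂ν' := by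
    have := eLpNorm_nnreal_pow_eq_lintegral (μ := ν') (f := fun x => f x - c) (p := 2) (by norm_num)
    simpa using this
  calc ‖(⨍ x, f x ∂ν) - c‖ₑ ^ 2 ≤ eLpNorm (fun x => f x - c) 2 ν' ^ 2 := by
        rw [h1]; gcongr
    _ = _ := by rw [h3, hν', lintegral_smul_measure]; rfl

/-- Jensen twice: over `A` against the constant average on `B`, then over `B` against the constant
`f x`. -/
theorem enorm_average_sub_average_sq_le {α : Type*} [MeasurableSpace α] {μ : Measure α}
    [IsFiniteMeasure μ] {A B : Set α} (hA : μ A ≠ 0) (hB : μ B ≠ 0) {f : α → ℝ}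
    (hf : Integrable f μ) :
    ‖(⨍ x in A, f x ∂μ) - ⨍ x in B, f x ∂μ‖ₑ ^ 2 ≤
      (μ A)⁻¹ * (μ B)⁻¹ * ∫⁻ x in A, ∫⁻ y in B, edist (f x) (f y) ^ 2 ∂μ ∂μ := by
  refine (enorm_average_sub_sq_le (by simpa using hA) hf.integrableOn _).trans ?_
  rw [Measure.restrict_apply_univ, mul_assoc,
    ← lintegral_const_mul' (μ B)⁻¹ _ (by simpa using hB)]
  refine mul_le_mul_right (lintegral_mono fun x => ?_) _
  have := enorm_average_sub_sq_le (ν := μ.restrict B) (by simpa using hB) hf.integrableOn (f x)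
  rw [Measure.restrict_apply_univ] at this
  rw [← edist_eq_enorm_sub, edist_comm, edist_eq_enorm_sub]
  simpa [edist_comm (f x), edist_eq_enorm_sub] using this

/-- The lower integral is superadditive without measurability, and only this direction is needed for
the energy kernels. -/
theorem finset_sum_lintegral_le {α ι : Type*} [MeasurableSpace α] (μ : Measure α) (s : Finset ι)
    (f : ι → α → ℝ≥0∞) : ∑ i ∈ s, ∫⁻ x, f i x ∂μ ≤ ∫⁻ x, ∑ i ∈ s, f i x ∂μ := by
  classical
  induction s using Finset.induction_on with
  | empty => simp
  | insert i s hi ih =>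
    simp only [Finset.sum_insert hi]
    exact (add_le_add_right ih _).trans (le_lintegral_add _ _)

theorem sum_two_pow_filter_le (m N : ℕ) (hm : 1 ≤ m) (T : ℝ) (hT : 0 ≤ T) :
    ∑ k ∈ (Finset.range N).filter (fun k => (2 : ℝ) ^ k < T), ((2 : ℝ) ^ k) ^ m ≤ 2 * T ^ m := by
  have geom : ∀ K : ℕ, ∑ k ∈ Finset.range (K + 1), ((2 : ℝ) ^ k) ^ m ≤ 2 * ((2 : ℝ) ^ K) ^ m := by
    intro K
    induction K with
    | zero => simp
    | succ K ih =>
      rw [Finset.sum_range_succ]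
      have h2 : (2 : ℝ) ≤ 2 ^ m := by
        calc (2 : ℝ) = 2 ^ 1 := by norm_num
          _ ≤ 2 ^ m := pow_le_pow_right₀ (by norm_num) hm
      have : 2 * ((2 : ℝ) ^ K) ^ m ≤ ((2 : ℝ) ^ (K + 1)) ^ m := by
        rw [pow_succ (2 : ℝ) K, mul_pow, mul_comm]
        gcongr
      linarith
  induction N with
  | zero => simp; positivity
  | succ N ih =>
    by_cases h : (2 : ℝ) ^ N < T
    · refine (Finset.sum_le_sum_of_subset_of_nonneg (Finset.filter_subset _ _)
        fun _ _ _ => by positivity).trans ((geom N).trans ?_)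
      gcongr
    · rwa [Finset.range_add_one, Finset.filter_insert, if_neg h]

section Balls

variable {X : Type*} [MetricSpace X] [MeasurableSpace X] [OpensMeasurableSpace X]

/-- A pair `y, z` occurs at scale `k` only if `2 ^ k < 2 l / dist y z`. The weights of these scales
form a geometric sum dominated by its largest term, which yields the singular kernel. So all scales
together cost one energy, whatever `x` and `N`. -/
theorem sum_dyadic_energy_le (μ : Measure X) (v : X → ℝ) (x : X) {l : ℝ} (hl : 0 < l) (m N : ℕ)
    (hm : 1 ≤ m) :
    ∑ k ∈ Finset.range N, ENNReal.ofReal ((2 ^ k / l) ^ m) *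
        ∫⁻ y in Metric.ball x (l / 2 ^ k), ∫⁻ z in Metric.ball x (l / 2 ^ (k + 1)),
          edist (v y) (v z) ^ 2 ∂μ ∂μ ≤
      ENNReal.ofReal (2 ^ (m + 1)) *
        ∫⁻ y, ∫⁻ z, edist (v y) (v z) ^ 2 / edist y z ^ m ∂μ ∂μ := by
  classical
  set P : ℕ → X → X → ℝ≥0∞ := fun k y z =>
    if dist y z < 2 * (l / 2 ^ k) then ENNReal.ofReal ((2 ^ k / l) ^ m) * edist (v y) (v z) ^ 2
    else 0 with hP
  have step : ∀ k, ENNReal.ofReal ((2 ^ k / l) ^ m) *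
        ∫⁻ y in Metric.ball x (l / 2 ^ k), ∫⁻ z in Metric.ball x (l / 2 ^ (k + 1)),
          edist (v y) (v z) ^ 2 ∂μ ∂μ ≤ ∫⁻ y, ∫⁻ z, P k y z ∂μ ∂μ := by
    intro k
    rw [← lintegral_const_mul' _ _ ENNReal.ofReal_ne_top]
    refine le_trans ?_ (setLIntegral_le_lintegral (Metric.ball x (l / 2 ^ k)) _)
    refine setLIntegral_mono' Metric.isOpen_ball.measurableSet fun y hy => ?_
    rw [← lintegral_const_mul' _ _ ENNReal.ofReal_ne_top]
    refine le_trans ?_ (setLIntegral_le_lintegral (Metric.ball x (l / 2 ^ (k + 1))) _)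
    refine setLIntegral_mono' Metric.isOpen_ball.measurableSet fun z hz => ?_
    have : dist y z < 2 * (l / 2 ^ k) := by
      have h1 : l / 2 ^ (k + 1) ≤ l / 2 ^ k := by
        gcongr
        · norm_num
        · omega
      have := dist_triangle_right y z x
      rw [Metric.mem_ball] at hy hz
      linarith
    simp [hP, this]
  refine (Finset.sum_le_sum fun k _ => step k).trans ((finset_sum_lintegral_le _ _ _).trans ?_)
  rw [← lintegral_const_mul' _ _ ENNReal.ofReal_ne_top]
  refine lintegral_mono fun y => (finset_sum_lintegral_le _ _ _).trans ?_
  rw [← lintegral_const_mul' _ _ ENNReal.ofReal_ne_top]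
  refine lintegral_mono fun z => ?_
  rcases eq_or_ne y z with rfl | hne
  · simp [hP]
  have hd : 0 < dist y z := dist_pos.2 hne
  have h1 : ∑ k ∈ Finset.range N, P k y z =
      ENNReal.ofReal (∑ k ∈ (Finset.range N).filter (fun k => (2 : ℝ) ^ k < 2 * l / dist y z),
        (2 ^ k / l) ^ m) * edist (v y) (v z) ^ 2 := by
    rw [ENNReal.ofReal_sum_of_nonneg fun _ _ => by positivity, Finset.sum_mul, Finset.sum_filter]
    refine Finset.sum_congr rfl fun k _ => ?_
    have : dist y z < 2 * (l / 2 ^ k) ↔ (2 : ℝ) ^ k < 2 * l / dist y z := by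
      rw [← mul_div_assoc, lt_div_iff₀ (by positivity), lt_div_iff₀ hd, mul_comm]
    simp only [hP, this]
  have h2 : ∑ k ∈ (Finset.range N).filter (fun k => (2 : ℝ) ^ k < 2 * l / dist y z),
      ((2 : ℝ) ^ k / l) ^ m ≤ 2 ^ (m + 1) / dist y z ^ m := by
    have := sum_two_pow_filter_le m N hm (2 * l / dist y z) (by positivity)
    simp only [div_pow _ l]
    rw [← Finset.sum_div, div_le_iff₀ (by positivity)]
    refine this.trans (le_of_eq ?_)
    rw [div_pow, mul_pow]
    field_simp
    ring
  rw [h1]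
  calc _ ≤ ENNReal.ofReal (2 ^ (m + 1) / dist y z ^ m) * edist (v y) (v z) ^ 2 := by gcongr
    _ = _ := by
      rw [ENNReal.ofReal_div_of_pos (by positivity), ENNReal.ofReal_pow hd.le, ← edist_dist]
      simp only [div_eq_mul_inv]
      ring

end Balls

/-! ### Sets with a lower bound on the measure of balls -/

section LowerRegular

variable {X : Type*} [MetricSpace X] [MeasurableSpace X] [OpensMeasurableSpace X]
  {μ : Measure X} [IsFiniteMeasure μ] {v : X → ℝ} {x : X} {c l V W : ℝ} {e : ℕ}

theorem sq_average_ball_le (hv : Integrable v μ) (hc : 0 < c) (hl : 0 < l) (hV : 0 ≤ V)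
    (hW : 0 ≤ W)
    (hx : ∀ ρ, 0 < ρ → ρ ≤ l → ENNReal.ofReal (c * ρ ^ (e + 1)) ≤ μ (Metric.ball x ρ))
    (hvV : ∫⁻ y, ‖v y‖ₑ ^ 2 ∂μ ≤ ENNReal.ofReal V)
    (hvW : ∫⁻ y, ∫⁻ z, edist (v y) (v z) ^ 2 / edist y z ^ (e + 2) ∂μ ∂μ ≤ ENNReal.ofReal W)
    (N : ℕ) :
    (⨍ y in Metric.ball x (l / 2 ^ N), v y ∂μ) ^ 2 ≤
      2 * ((∑ k ∈ Finset.range N, (2 ^ k / l) ^ e) * (2 ^ (2 * e + 4) / c ^ 2 * W) +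
        V / (c * l ^ (e + 1))) := by
  set m : ℕ → ℝ := fun k => ⨍ y in Metric.ball x (l / 2 ^ k), v y ∂μ with hm
  have hinv : ∀ k, (μ (Metric.ball x (l / 2 ^ k)))⁻¹ ≤
      ENNReal.ofReal ((2 ^ k / l) ^ (e + 1) / c) := by
    intro k
    have h := hx (l / 2 ^ k) (by positivity)
      (div_le_self hl.le (one_le_pow₀ (by norm_num)))
    refine (ENNReal.inv_le_inv.2 h).trans (le_of_eq ?_)
    rw [← ENNReal.ofReal_inv_of_pos (by positivity), mul_inv, ← inv_pow, inv_div]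
    congr 1
    field_simp
  have hne : ∀ k, μ (Metric.ball x (l / 2 ^ k)) ≠ 0 := fun k h => by
    have := hinv k
    simp [h] at this
  -- The two inverse measures contribute the power `2 * (e + 1)` of `2 ^ k / l`; division by the
  -- weight leaves `e + 2`, the exponent of the kernel.
  have hstep : ∀ k, ENNReal.ofReal ((m k - m (k + 1)) ^ 2 / (2 ^ k / l) ^ e) ≤
      ENNReal.ofReal (2 ^ (e + 1) / c ^ 2) * (ENNReal.ofReal ((2 ^ k / l) ^ (e + 2)) *
        ∫⁻ y in Metric.ball x (l / 2 ^ k), ∫⁻ z in Metric.ball x (l / 2 ^ (k + 1)),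
          edist (v y) (v z) ^ 2 ∂μ ∂μ) := by
    intro k
    have h := enorm_average_sub_average_sq_le (hne k) (hne (k + 1)) hv
    rw [div_eq_inv_mul, ENNReal.ofReal_mul (by positivity), ← sq_abs,
      ENNReal.ofReal_pow (abs_nonneg _), ← Real.enorm_eq_ofReal_abs, ← mul_assoc]
    calc _ ≤ ENNReal.ofReal (((2 ^ k / l) ^ e)⁻¹) * (ENNReal.ofReal ((2 ^ k / l) ^ (e + 1) / c) *
          ENNReal.ofReal ((2 ^ (k + 1) / l) ^ (e + 1) / c) *
          ∫⁻ y in Metric.ball x (l / 2 ^ k), ∫⁻ z in Metric.ball x (l / 2 ^ (k + 1)),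
          edist (v y) (v z) ^ 2 ∂μ ∂μ) := by
          refine mul_le_mul_right (h.trans ?_) _
          gcongr
          · exact hinv k
          · exact hinv (k + 1)
      _ = _ := by
          rw [← mul_assoc, ← mul_assoc, ← ENNReal.ofReal_mul (by positivity),
            ← ENNReal.ofReal_mul (by positivity), ← ENNReal.ofReal_mul (by positivity)]
          congr 2
          rw [pow_succ (2 : ℝ) k, mul_div_right_comm]
          have : (2 : ℝ) ^ k / l ≠ 0 := by positivity
          generalize (2 : ℝ) ^ k / l = t at this
          field_simp
          ring
  have hsum : ∑ k ∈ Finset.range N, (m k - m (k + 1)) ^ 2 / (2 ^ k / l) ^ e ≤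
      2 ^ (2 * e + 4) / c ^ 2 * W := by
    rw [← ENNReal.ofReal_le_ofReal_iff (by positivity),
      ENNReal.ofReal_sum_of_nonneg fun _ _ => by positivity]
    refine (Finset.sum_le_sum fun k _ => hstep k).trans ?_
    rw [← Finset.mul_sum]
    calc _ ≤ ENNReal.ofReal (2 ^ (e + 1) / c ^ 2) * (ENNReal.ofReal (2 ^ (e + 2 + 1)) *
          ENNReal.ofReal W) := by
          refine mul_le_mul_right ((sum_dyadic_energy_le μ v x hl (e + 2) N (by omega)).trans ?_) _
          gcongr
      _ = _ := by
          rw [← mul_assoc, ← ENNReal.ofReal_mul (by positivity),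
            ← ENNReal.ofReal_mul (by positivity)]
          congr 2
          ring
  have hcs : (m 0 - m N) ^ 2 ≤ (∑ k ∈ Finset.range N, (2 ^ k / l) ^ e) *
      (2 ^ (2 * e + 4) / c ^ 2 * W) := by
    have htel : ∑ k ∈ Finset.range N, (m k - m (k + 1)) = m 0 - m N :=
      Finset.sum_range_sub' m N
    rw [← htel]
    refine (Finset.sum_sq_le_sum_mul_sum_of_sq_le_mul (Finset.range N)
      (f := fun k => (2 ^ k / l) ^ e) (g := fun k => (m k - m (k + 1)) ^ 2 / (2 ^ k / l) ^ e)
      (fun _ _ => by positivity) (fun _ _ => by positivity) fun k _ => ?_).trans ?_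
    · rw [mul_div_cancel₀ _ (by positivity)]
    · exact mul_le_mul_of_nonneg_left hsum (Finset.sum_nonneg fun _ _ => by positivity)
  have h0 : m 0 ^ 2 ≤ V / (c * l ^ (e + 1)) := by
    have h := enorm_average_sub_sq_le (ν := μ.restrict (Metric.ball x (l / 2 ^ 0)))
      (by simpa using hne 0) hv.integrableOn 0
    simp only [sub_zero, Measure.restrict_apply_univ] at h
    rw [← ENNReal.ofReal_le_ofReal_iff (by positivity), ← sq_abs,
      ENNReal.ofReal_pow (abs_nonneg _), ← Real.enorm_eq_ofReal_abs]
    refine h.trans ((mul_le_mul' (hinv 0) ((setLIntegral_le_lintegral _ _).trans hvV)).trans_eq ?_)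
    rw [← ENNReal.ofReal_mul (by positivity), pow_zero, div_pow, one_pow]
    congr 1
    field_simp
  have : m N ^ 2 ≤ 2 * ((m 0 - m N) ^ 2 + m 0 ^ 2) := by nlinarith [sq_nonneg (2 * m 0 - m N)]
  exact this.trans (by linarith)

theorem enorm_sq_le_of_ball (hv : Integrable v μ) (hc : 0 < c) (hl : 0 < l) (hV : 0 ≤ V)
    (hW : 0 ≤ W)
    (hx : ∀ ρ, 0 < ρ → ρ ≤ l → ENNReal.ofReal (c * ρ ^ (e + 1)) ≤ μ (Metric.ball x ρ))
    (hvV : ∫⁻ y, ‖v y‖ₑ ^ 2 ∂μ ≤ ENNReal.ofReal V)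
    (hvW : ∫⁻ y, ∫⁻ z, edist (v y) (v z) ^ 2 / edist y z ^ (e + 2) ∂μ ∂μ ≤ ENNReal.ofReal W)
    (N : ℕ) :
    ‖v x‖ₑ ^ 2 ≤ ENNReal.ofReal (2 / c * (l / 2 ^ N)) *
        ∫⁻ y, edist (v x) (v y) ^ 2 / edist x y ^ (e + 2) ∂μ +
      ENNReal.ofReal (4 * ((∑ k ∈ Finset.range N, (2 ^ k / l) ^ e) *
        (2 ^ (2 * e + 4) / c ^ 2 * W) + V / (c * l ^ (e + 1)))) := by
  have hA := sq_average_ball_le hv hc hl hV hW hx hvV hvW N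
  set r : ℝ := l / 2 ^ N with hr
  have hr0 : 0 < r := by positivity
  have hμ := hx r hr0 (div_le_self hl.le (one_le_pow₀ (by norm_num)))
  set a : ℝ := ⨍ y in Metric.ball x r, v y ∂μ with ha
  have hne : μ (Metric.ball x r) ≠ 0 := fun h => by
    rw [h, nonpos_iff_eq_zero, ENNReal.ofReal_eq_zero] at hμ
    have : 0 < c * r ^ (e + 1) := by positivity
    linarith
  -- On the ball the kernel is at least `r ^ (-(e + 2))`, while the measure is at least `c * r ^ (e
  -- + 1)`: one factor `r` is gained.
  have h1 : ‖a - v x‖ₑ ^ 2 ≤ ENNReal.ofReal (1 / c * r) *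
      ∫⁻ y, edist (v x) (v y) ^ 2 / edist x y ^ (e + 2) ∂μ := by
    have h := enorm_average_sub_sq_le (ν := μ.restrict (Metric.ball x r))
      (by simpa using hne) hv.integrableOn (v x)
    rw [Measure.restrict_apply_univ] at h
    refine h.trans ?_
    have h2 : ∫⁻ y in Metric.ball x r, ‖v y - v x‖ₑ ^ 2 ∂μ ≤ ENNReal.ofReal (r ^ (e + 2)) *
        ∫⁻ y, edist (v x) (v y) ^ 2 / edist x y ^ (e + 2) ∂μ := by
      rw [← lintegral_const_mul' _ _ ENNReal.ofReal_ne_top]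
      refine le_trans ?_ (setLIntegral_le_lintegral (Metric.ball x r) _)
      refine setLIntegral_mono' Metric.isOpen_ball.measurableSet fun y hy => ?_
      rcases eq_or_ne x y with rfl | hxy
      · simp
      rw [← edist_eq_enorm_sub, edist_comm, ENNReal.ofReal_pow hr0.le]
      calc edist (v x) (v y) ^ 2
          = edist x y ^ (e + 2) * (edist (v x) (v y) ^ 2 / edist x y ^ (e + 2)) := by
            rw [ENNReal.mul_div_cancel (by simp [hxy]) (ENNReal.pow_ne_top (edist_ne_top _ _))]
        _ ≤ _ := by
            gcongr
            rw [edist_dist]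
            rw [Metric.mem_ball'] at hy
            exact ENNReal.ofReal_le_ofReal hy.le
    refine (mul_le_mul' (ENNReal.inv_le_inv.2 hμ) h2).trans (le_of_eq ?_)
    rw [← mul_assoc, ← ENNReal.ofReal_inv_of_pos (by positivity),
      ← ENNReal.ofReal_mul (by positivity)]
    congr 2
    field_simp
    ring
  have h3 : ‖v x‖ₑ ^ 2 ≤ 2 * ‖a - v x‖ₑ ^ 2 + 2 * ENNReal.ofReal (a ^ 2) := by
    have h4 : ∀ t : ℝ, ‖t‖ₑ ^ 2 = ENNReal.ofReal (t ^ 2) := fun t => by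
      rw [Real.enorm_eq_ofReal_abs, ← ENNReal.ofReal_pow (abs_nonneg _), sq_abs]
    rw [h4, h4, show (2 : ℝ≥0∞) = ENNReal.ofReal 2 by simp, ← ENNReal.ofReal_mul (by norm_num),
      ← ENNReal.ofReal_mul (by norm_num), ← ENNReal.ofReal_add (by positivity) (by positivity)]
    exact ENNReal.ofReal_le_ofReal (by nlinarith [sq_nonneg (2 * a - v x)])
  refine h3.trans (add_le_add ?_ ?_)
  · refine (mul_le_mul_right h1 _).trans (le_of_eq ?_)
    rw [← mul_assoc, show (2 : ℝ≥0∞) = ENNReal.ofReal 2 by simp,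
      ← ENNReal.ofReal_mul (by norm_num)]
    congr 2
    ring
  · rw [show (2 : ℝ≥0∞) = ENNReal.ofReal 2 by simp, ← ENNReal.ofReal_mul (by norm_num)]
    exact ENNReal.ofReal_le_ofReal (by linarith)

/-- The integral of `v ^ 2` over a subset `S`, in terms of the measure of `S`, the `L²`-norm and
the Slobodeckij seminorm of order `1/2`. -/
theorem setLIntegral_sq_le_of_ball {S : Set X} (hS : MeasurableSet S) (hv : Integrable v μ)
    (hc : 0 < c) (hl : 0 < l) (hV : 0 ≤ V) (hW : 0 ≤ W)
    (hx : ∀ x ∈ S, ∀ ρ, 0 < ρ → ρ ≤ l → ENNReal.ofReal (c * ρ ^ (e + 1)) ≤ μ (Metric.ball x ρ))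
    (hvV : ∫⁻ y, ‖v y‖ₑ ^ 2 ∂μ ≤ ENNReal.ofReal V)
    (hvW : ∫⁻ y, ∫⁻ z, edist (v y) (v z) ^ 2 / edist y z ^ (e + 2) ∂μ ∂μ ≤ ENNReal.ofReal W)
    (N : ℕ) :
    ∫⁻ y in S, ‖v y‖ₑ ^ 2 ∂μ ≤ ENNReal.ofReal (2 / c * (l / 2 ^ N) * W +
      4 * ((∑ k ∈ Finset.range N, (2 ^ k / l) ^ e) *
        (2 ^ (2 * e + 4) / c ^ 2 * W) + V / (c * l ^ (e + 1))) * (μ S).toReal) := by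
  have hs : 0 ≤ ∑ k ∈ Finset.range N, ((2 : ℝ) ^ k / l) ^ e :=
    Finset.sum_nonneg fun _ _ => by positivity
  refine (setLIntegral_mono' hS fun x hxS =>
    enorm_sq_le_of_ball hv hc hl hV hW (hx x hxS) hvV hvW N).trans ?_
  -- Measurability of the constant summand alone is enough to split the integral.
  rw [lintegral_add_right _ measurable_const, lintegral_const_mul' _ _ ENNReal.ofReal_ne_top,
    lintegral_const, Measure.restrict_apply_univ, ENNReal.ofReal_add (by positivity) (by positivity),
    ENNReal.ofReal_mul (q := W) (by positivity), ENNReal.ofReal_mul (q := (μ S).toReal) (by positivity),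
    ENNReal.ofReal_toReal (measure_ne_top μ S)]
  gcongr
  exact (setLIntegral_le_lintegral _ _).trans hvW

end LowerRegular

/-! ### Intrinsic diameters -/

theorem dist_le_mul_of_forall_coord {n : ℕ} {x y : E n} {t : ℝ} (h : ∀ i, |x i - y i| ≤ t)
    (ht : 0 ≤ t) : dist x y ≤ n * t := by
  rw [EuclideanSpace.dist_eq]
  refine Real.sqrt_le_iff.2 ⟨by positivity, ?_⟩
  calc ∑ i, dist (x i) (y i) ^ 2 ≤ ∑ _i : Fin n, t ^ 2 := by
        refine Finset.sum_le_sum fun i _ => ?_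
        rw [Real.dist_eq]
        exact pow_le_pow_left₀ (abs_nonneg _) (h i) 2
    _ = n * t ^ 2 := by simp
    _ ≤ (n * t) ^ 2 := by
        rw [mul_pow]
        refine mul_le_mul_of_nonneg_right ?_ (sq_nonneg t)
        exact_mod_cast Nat.le_self_pow (by norm_num) n

theorem abs_coord_sub_le_dist {n : ℕ} (x y : E n) (i : Fin n) : |x i - y i| ≤ dist x y := by
  rw [dist_eq_norm]
  simpa using PiLp.norm_apply_le (x - y) i

theorem edist_le_pathDist {n : ℕ} (W : Set (E n)) (x y : E n) : edist x y ≤ pathDist W x y := by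
  refine le_iInf₂ fun γ hγ => ?_
  have := eVariationOn.edist_le γ (s := Icc 0 1) (x := 0) (y := 1) (by simp) (by simp)
  rwa [hγ.source, hγ.target] at this

section PathDiam

variable {n : ℕ} {Φ : E n → E n} {B T : Set (E n)} {Λ R : ℝ}

/-- The image of the straight segment is an admissible path. In the applications `B` is an open cell
or one of its sides and `T` is the closed cell. -/
theorem pathDist_image_le (hB : Convex ℝ B) (hBT : B ⊆ T) (hΦ : ContDiffOn ℝ ∞ Φ T) (hΛ : 0 ≤ Λ)
    (hL : ∀ x ∈ B, ∀ y ∈ B, dist (Φ x) (Φ y) ≤ Λ * dist x y) {p q : E n} (hp : p ∈ B)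
    (hq : q ∈ B) : pathDist (Φ '' B) (Φ p) (Φ q) ≤ ENNReal.ofReal (Λ * dist p q) := by
  set γ₀ : ℝ → E n := fun t => AffineMap.lineMap p q t with hγ₀
  have hmem : ∀ t ∈ Icc (0 : ℝ) 1, γ₀ t ∈ B := fun t ht => hB.lineMap_mem hp hq ht
  have hsmooth : ContDiff ℝ 1 γ₀ := by
    simp only [hγ₀, AffineMap.lineMap_apply, vsub_eq_sub, vadd_eq_add]
    fun_prop
  have hcd : ContDiffOn ℝ 1 (Φ ∘ γ₀) (Icc 0 1) :=
    (hΦ.of_le (by norm_cast)).comp hsmooth.contDiffOn fun t ht => hBT (hmem t ht)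
  have hpath : IsPiecewiseC1Path (Φ '' B) (Φ p) (Φ q) (Φ ∘ γ₀) := by
    refine ⟨hcd.continuousOn, ⟨∅, fun s t hs _ ht _ => hcd.mono (Icc_subset_Icc hs ht)⟩, ?_, ?_,
      fun t ht => mem_image_of_mem _ (hmem t ht)⟩ <;> simp [hγ₀]
  have hlip : LipschitzOnWith (Λ * dist p q).toNNReal (Φ ∘ γ₀) (Icc 0 1) := by
    refine LipschitzOnWith.of_dist_le_mul fun s hs t ht => ?_
    rw [Real.coe_toNNReal _ (by positivity)]
    refine (hL _ (hmem s hs) _ (hmem t ht)).trans (le_of_eq ?_)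
    rw [hγ₀, dist_lineMap_lineMap]
    ring
  refine (iInf₂_le _ hpath).trans ?_
  have h1 := hlip.comp_eVariationOn_le (g := id) (s := Icc (0 : ℝ) 1) (mapsTo_id _)
  have h2 : eVariationOn (id : ℝ → ℝ) (Icc 0 1) ≤ 1 := by
    have := (monotone_id (α := ℝ)).monotoneOn (Icc 0 1) |>.eVariationOn_eq
      (a := 0) (b := 1) (by simp) (by simp)
    simp_all
  calc _ ≤ _ := h1
    _ ≤ ((Λ * dist p q).toNNReal : ℝ≥0∞) * 1 := by gcongr
    _ = _ := by rw [mul_one]; rfl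

theorem iSup_pathDist_image_le (hB : Convex ℝ B) (hBT : B ⊆ T) (hΦ : ContDiffOn ℝ ∞ Φ T)
    (hΛ : 0 ≤ Λ) (hL : ∀ x ∈ B, ∀ y ∈ B, dist (Φ x) (Φ y) ≤ Λ * dist x y)
    (hR : ∀ x ∈ B, ∀ y ∈ B, dist x y ≤ R) :
    ⨆ x ∈ Φ '' B, ⨆ y ∈ Φ '' B, pathDist (Φ '' B) x y ≤ ENNReal.ofReal (Λ * R) := by
  refine iSup₂_le ?_
  rintro _ ⟨p, hp, rfl⟩
  refine iSup₂_le ?_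
  rintro _ ⟨q, hq, rfl⟩
  refine (pathDist_image_le hB hBT hΦ hΛ hL hp hq).trans (ENNReal.ofReal_le_ofReal ?_)
  exact mul_le_mul_of_nonneg_left (hR p hp q hq) hΛ

theorem pathDiam_image_le (hB : Convex ℝ B) (hBT : B ⊆ T) (hΦ : ContDiffOn ℝ ∞ Φ T)
    (hΛ : 0 ≤ Λ) (hL : ∀ x ∈ B, ∀ y ∈ B, dist (Φ x) (Φ y) ≤ Λ * dist x y) (hR0 : 0 ≤ R)
    (hR : ∀ x ∈ B, ∀ y ∈ B, dist x y ≤ R) : pathDiam (Φ '' B) ≤ Λ * R :=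
  ENNReal.toReal_le_of_le_ofReal (by positivity) (iSup_pathDist_image_le hB hBT hΦ hΛ hL hR)

theorem dist_le_mul_pathDiam_image (hB : Convex ℝ B) (hBT : B ⊆ T) (hΦ : ContDiffOn ℝ ∞ Φ T)
    (hΛ : 0 ≤ Λ) (hL : ∀ x ∈ B, ∀ y ∈ B, dist (Φ x) (Φ y) ≤ Λ * dist x y)
    (hA : ∀ x ∈ B, ∀ y ∈ B, dist x y ≤ Λ * dist (Φ x) (Φ y))
    (hR : ∀ x ∈ B, ∀ y ∈ B, dist x y ≤ R) {p q : E n} (hp : p ∈ B) (hq : q ∈ B) :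
    dist p q ≤ Λ * pathDiam (Φ '' B) := by
  refine (hA p hp q hq).trans (mul_le_mul_of_nonneg_left ?_ hΛ)
  -- Finiteness matters: `toReal` would turn an infinite diameter into `0`.
  have htop := ne_top_of_le_ne_top ENNReal.ofReal_ne_top
    (iSup_pathDist_image_le hB hBT hΦ hΛ hL hR)
  rw [pathDiam, ← ENNReal.ofReal_le_iff_le_toReal htop, ← edist_dist]
  refine (edist_le_pathDist (Φ '' B) _ _).trans ?_
  refine le_trans ?_ (le_iSup₂ (f := fun x (_ : x ∈ Φ '' B) =>
    ⨆ y ∈ Φ '' B, pathDist (Φ '' B) x y) (Φ p) (mem_image_of_mem _ hp))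
  exact le_iSup₂ (f := fun y (_ : y ∈ Φ '' B) => pathDist (Φ '' B) (Φ p) y) (Φ q)
    (mem_image_of_mem _ hq)

end PathDiam

/-! ### Boxes -/

section Boxes

variable {n : ℕ} {a b : E n} {j : Fin n} {c : ℝ}

theorem closure_openBox (hab : ∀ i, a i < b i) :
    closure (openBox a b) = {x | ∀ i, x i ∈ Icc (a i) (b i)} := by
  have h1 : openBox a b = (EuclideanSpace.equiv (Fin n) ℝ).toHomeomorph ⁻¹'
      univ.pi fun i => Ioo (a i) (b i) := by
    ext x
    simp [openBox]
  rw [h1, ← Homeomorph.preimage_closure, closure_pi_set]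
  ext x
  simp only [closure_Ioo (hab _).ne, mem_preimage, mem_pi, mem_univ, true_imp_iff]
  rfl

theorem boxSide_subset_closure (hab : ∀ i, a i < b i) (hc : c = a j ∨ c = b j) :
    boxSide a b j c ⊆ closure (openBox a b) := by
  rw [closure_openBox hab]
  rintro x ⟨hxj, hx⟩ i
  rcases eq_or_ne i j with rfl | hi
  · rcases hc with h | h <;> rw [hxj, h]
    exacts [⟨le_rfl, (hab _).le⟩, ⟨(hab _).le, le_rfl⟩]
  · exact Ioo_subset_Icc_self (hx i hi)

theorem convex_openBox : Convex ℝ (openBox a b) := by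
  intro x hx y hy s t hs ht hst i
  exact convex_Ioo (a i) (b i) (hx i) (hy i) hs ht hst

theorem convex_boxSide : Convex ℝ (boxSide a b j c) := by
  intro x hx y hy s t hs ht hst
  refine ⟨?_, fun i hi => convex_Ioo (a i) (b i) (hx.2 i hi) (hy.2 i hi) hs ht hst⟩
  have : (s • x + t • y) j = s * x j + t * y j := by simp
  rw [this, hx.1, hy.1, ← add_mul, hst, one_mul]

theorem measurableSet_boxSide : MeasurableSet (boxSide a b j c) := by
  have hm : ∀ i, Measurable fun x : E n => x i := fun i => (by fun_prop : Continuous _).measurable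
  have : boxSide a b j c = {x | x j = c} ∩ ⋂ i, {x | i ≠ j → x i ∈ Ioo (a i) (b i)} := by
    ext x
    simp [boxSide]
  rw [this]
  refine (hm j (measurableSet_singleton c)).inter (MeasurableSet.iInter fun i => ?_)
  by_cases hi : i = j
  · simp [hi]
  · simp only [ne_eq, hi, not_false_eq_true, true_imp_iff]
    exact hm i measurableSet_Ioo

theorem dist_le_of_mem_closure_openBox (hab : ∀ i, a i < b i) {l : ℝ} (hl : 0 ≤ l)
    (hw : ∀ i, b i - a i ≤ l) {x y : E n} (hx : x ∈ closure (openBox a b))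
    (hy : y ∈ closure (openBox a b)) : dist x y ≤ n * l := by
  rw [closure_openBox hab] at hx hy
  refine dist_le_mul_of_forall_coord (fun i => ?_) hl
  have := hx i
  have := hy i
  have := hw i
  rw [abs_le]
  simp only [mem_Icc] at *
  constructor <;> linarith

end Boxes

theorem Hierarchy.IsActive.bounds {n : ℕ} {M : Hierarchy n} {a b : E n} (h : M.IsActive a b)
    (i : Fin n) : 0 ≤ a i ∧ a i < b i ∧ b i ≤ 1 := by
  obtain ⟨l, _, hg, _⟩ := h
  exact ⟨(M.grid_subset l i _ (hg i).1).1, (hg i).2.2.1, (M.grid_subset l i _ (hg i).2.1).2⟩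

/-! ### Shape regularity of the parametric cells -/

theorem lipschitzWith_toLp_nat (n : ℕ) :
    LipschitzWith n (fun x : Fin n → ℝ => (WithLp.toLp 2 x : E n)) :=
  LipschitzWith.of_dist_le_mul fun x y =>
    dist_le_mul_of_forall_coord (fun i => by simpa [Real.dist_eq] using dist_le_pi_dist x y i)
      dist_nonneg

theorem lipschitzWith_coord {n : ℕ} {ι : Type*} [Fintype ι] (g : ι → Fin n) :
    LipschitzWith 1 (fun (x : E n) i => x (g i)) :=
  LipschitzWith.of_dist_le_mul fun x y => by
    rw [NNReal.coe_one, one_mul, dist_pi_le_iff dist_nonneg]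
    exact fun i => by simpa [Real.dist_eq] using abs_coord_sub_le_dist x y (g i)

/-- A box whose image under a Lipschitz map contains a ball has volume comparable to that of the
ball. -/
theorem pow_le_prod_of_ball_subset_image {n : ℕ} {a b : E n} (hab : ∀ i, a i < b i)
    {Φ : E n → E n} {Λ : ℝ} (hΛ : 0 ≤ Λ)
    (hL : ∀ x ∈ openBox a b, ∀ y ∈ openBox a b, dist (Φ x) (Φ y) ≤ Λ * dist x y)
    {x : E n} {r : ℝ} (hr : 0 < r) (hn : 0 < n) (hx : Metric.ball x r ⊆ Φ '' openBox a b) :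
    (2 * r / n) ^ n ≤ (Λ * n) ^ n * ∏ i, (b i - a i) := by
  have hn' : (0 : ℝ) < n := by exact_mod_cast hn
  -- In the sup norm, Hausdorff measure of full dimension is Lebesgue measure; the change of norm
  -- costs factors of `n`.
  set G : (Fin n → ℝ) → Fin n → ℝ := fun t i => Φ (WithLp.toLp 2 t) i with hG
  set Q : Set (Fin n → ℝ) := univ.pi fun i => Ioo (a i) (b i) with hQ
  have hQmem : ∀ t ∈ Q, (WithLp.toLp 2 t : E n) ∈ openBox a b := fun t ht i => ht i (mem_univ i)
  have hGL : LipschitzOnWith (Λ * n).toNNReal G Q := by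
    refine LipschitzOnWith.of_dist_le_mul fun s hs t ht => ?_
    rw [Real.coe_toNNReal _ (by positivity)]
    have h1 := (lipschitzWith_coord (id : Fin n → Fin n)).dist_le_mul
      (Φ (WithLp.toLp 2 s)) (Φ (WithLp.toLp 2 t))
    have h2 := hL _ (hQmem s hs) _ (hQmem t ht)
    have h3 := (lipschitzWith_toLp_nat n).dist_le_mul s t
    simp only [NNReal.coe_one, one_mul, id_eq, NNReal.coe_natCast] at h1 h3
    calc _ ≤ _ := h1
      _ ≤ _ := h2
      _ ≤ Λ * (n * dist s t) := by gcongr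
      _ = _ := by ring
  have hsub : Metric.ball (fun i => x i) (r / n) ⊆ G '' Q := by
    intro t ht
    have h : (WithLp.toLp 2 t : E n) ∈ Metric.ball x r := by
      rw [Metric.mem_ball, lt_div_iff₀ hn'] at ht
      have := (lipschitzWith_toLp_nat n).dist_le_mul t fun i => x i
      rw [Metric.mem_ball]
      refine lt_of_le_of_lt this ?_
      rw [mul_comm]
      exact_mod_cast ht
    obtain ⟨p, hp, hpt⟩ := hx h
    refine ⟨fun i => p i, fun i _ => hp i, ?_⟩
    funext i
    simp only [hG]
    change Φ p i = t i
    rw [hpt]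
  have hvol := hGL.hausdorffMeasure_image_le (d := (Fintype.card (Fin n) : ℝ)) (by positivity)
  rw [hausdorffMeasure_pi_real] at hvol
  have h := (measure_mono (μ := volume) hsub).trans hvol
  rw [Real.volume_pi_ball _ (by positivity), hQ, Real.volume_pi_Ioo, Fintype.card_fin,
    ENNReal.rpow_natCast, ← ENNReal.ofReal_prod_of_nonneg fun i _ => (sub_pos.2 (hab i)).le] at h
  change _ ≤ ENNReal.ofReal (Λ * n) ^ n * _ at h
  have hp : 0 ≤ ∏ i, (b i - a i) := Finset.prod_nonneg fun i _ => (sub_pos.2 (hab i)).le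
  rw [← ENNReal.ofReal_pow (by positivity), ← ENNReal.ofReal_mul (by positivity),
    ENNReal.ofReal_le_ofReal_iff (by positivity)] at h
  rwa [mul_div_assoc]

/-- The lower bound on the ratio of the widths of a parametric cell. -/
noncomputable def widthRatio (n : ℕ) (Λ σ : ℝ) : ℝ := (1 / (2 * Λ ^ 2 * σ * n ^ 2)) ^ n

/-- The longest edge `l` bounds the diameter of the physical cell from below, so the cell contains a
ball of radius comparable to `l`, and the box has volume at least a multiple of `l ^ n`. The other
`n - 1` widths are at most `l`, hence none can be small. -/
theorem widthRatio_mul_le {n : ℕ} (hn : 0 < n) {a b : E n} (hab : ∀ i, a i < b i)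
    {Φ : E n → E n} {Λ σ : ℝ} (hΛ : 0 < Λ) (hσ : 0 < σ)
    (hL : ∀ x ∈ openBox a b, ∀ y ∈ openBox a b, dist (Φ x) (Φ y) ≤ Λ * dist x y)
    (hA : ∀ x ∈ openBox a b, ∀ y ∈ openBox a b, dist x y ≤ Λ * dist (Φ x) (Φ y))
    (hΦ : ContDiffOn ℝ ∞ Φ (closure (openBox a b)))
    (hsr : pathDiam (Φ '' openBox a b) ≤ σ * inradius (Φ '' openBox a b)) {l : ℝ} (i₀ : Fin n)
    (hl : b i₀ - a i₀ = l) (hw : ∀ i, b i - a i ≤ l) (i : Fin n) :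
    widthRatio n Λ σ * l ≤ b i - a i := by
  have hn' : (0 : ℝ) < n := by exact_mod_cast hn
  have hl0 : 0 < l := hl ▸ sub_pos.2 (hab i₀)
  set p : ℝ → E n := fun s => WithLp.toLp 2 fun i => a i + s * (b i - a i) with hp
  have hpm : ∀ s ∈ Ioo (0 : ℝ) 1, p s ∈ openBox a b := by
    intro s hs i
    have := sub_pos.2 (hab i)
    simp only [hp, mem_Ioo]
    constructor <;> nlinarith [hs.1, hs.2]
  have hdiam : l / 2 ≤ Λ * pathDiam (Φ '' openBox a b) := by
    have h1 := dist_le_mul_pathDiam_image convex_openBox subset_closure hΦ hΛ.le hL hA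
      (R := n * l) (fun x hx y hy => dist_le_of_mem_closure_openBox hab hl0.le hw
        (subset_closure hx) (subset_closure hy))
      (hpm (3 / 4) (by norm_num)) (hpm (1 / 4) (by norm_num))
    refine le_trans ?_ ((abs_coord_sub_le_dist _ _ i₀).trans h1)
    refine le_trans (le_of_eq ?_) (le_abs_self _)
    simp only [hp, hl]
    ring
  -- The argument gives `l / (2 * Λ * σ)`; halving it makes the inequality strict, so that an actual
  -- ball beats the bound.
  have hlt : l / (4 * Λ * σ) < inradius (Φ '' openBox a b) := by
    rw [div_lt_iff₀ (by positivity)]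
    nlinarith [mul_le_mul_of_nonneg_left hsr hΛ.le]
  obtain ⟨r, ⟨x, hx⟩, hr⟩ := exists_lt_of_lt_csSup (s := {r : ℝ | ∃ x, Metric.ball x r ⊆ Φ '' openBox a b})
    ⟨0, 0, by simp⟩ hlt
  have hr0 : 0 < r := lt_trans (by positivity) hr
  have hvol := pow_le_prod_of_ball_subset_image hab hΛ.le hL hr0 hn hx
  have hprod : ∏ k, (b k - a k) ≤ (b i - a i) * l ^ (n - 1) := by
    rw [← Finset.mul_prod_erase _ _ (Finset.mem_univ i)]
    refine mul_le_mul_of_nonneg_left ?_ (sub_pos.2 (hab i)).le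
    refine (Finset.prod_le_prod (fun k _ => (sub_pos.2 (hab k)).le) fun k _ => hw k).trans
      (le_of_eq ?_)
    simp
  have h3 : (2 * (l / (4 * Λ * σ)) / n) ^ n ≤ (Λ * n) ^ n * ((b i - a i) * l ^ (n - 1)) := by
    refine le_trans ?_ (hvol.trans (mul_le_mul_of_nonneg_left hprod (by positivity)))
    gcongr
  have h4 : (2 * (l / (4 * Λ * σ)) / n) ^ n =
      (Λ * n) ^ n * (widthRatio n Λ σ * l * l ^ (n - 1)) := by
    rw [mul_assoc (widthRatio n Λ σ), mul_pow_sub_one hn.ne', widthRatio, ← mul_pow, ← mul_pow]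
    congr 1
    field_simp
    ring
  rw [h4] at h3
  have h5 := le_of_mul_le_mul_left h3 (by positivity)
  exact le_of_mul_le_mul_right h5 (by positivity)

theorem widthRatio_pos {n : ℕ} (hn : 0 < n) {Λ σ : ℝ} (hΛ : 0 < Λ) (hσ : 0 < σ) :
    0 < widthRatio n Λ σ := by
  have hn' : (0 : ℝ) < n := by exact_mod_cast hn
  unfold widthRatio
  positivity

theorem widthRatio_le_one {n : ℕ} (hn : 0 < n) {Λ σ : ℝ} (hΛ : 1 ≤ Λ) (hσ : 1 ≤ σ) :
    widthRatio n Λ σ ≤ 1 := by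
  have hn' : (1 : ℝ) ≤ n := by exact_mod_cast hn
  refine pow_le_one₀ (by positivity) ?_
  rw [div_le_one (by positivity)]
  have h1 : 1 ≤ Λ ^ 2 := one_le_pow₀ hΛ
  have h2 : (1 : ℝ) ≤ (n : ℝ) ^ 2 := one_le_pow₀ hn'
  have h3 : 1 ≤ Λ ^ 2 * σ := one_le_mul_of_one_le_of_one_le h1 hσ
  have h4 : 1 ≤ Λ ^ 2 * σ * n ^ 2 := one_le_mul_of_one_le_of_one_le h3 h2
  nlinarith

/-! ### The surface measure of a face -/

section Face

variable {n : ℕ} {a b : E n} {j : Fin n} {c Λ : ℝ} {Φ : E n → E n}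

/-- The point with `j`-th coordinate `c` and the other coordinates given by `t`. -/
noncomputable def insertCoord (j : Fin n) (c : ℝ) (t : {i // i ≠ j} → ℝ) : E n :=
  WithLp.toLp 2 fun i => if h : i ≠ j then t ⟨i, h⟩ else c

theorem insertCoord_of_ne (t : {i // i ≠ j} → ℝ) {i : Fin n} (h : i ≠ j) :
    insertCoord j c t i = t ⟨i, h⟩ := by simp [insertCoord, h]

theorem insertCoord_self (t : {i // i ≠ j} → ℝ) : insertCoord j c t j = c := by
  simp [insertCoord]

theorem dist_insertCoord_le (s t : {i // i ≠ j} → ℝ) :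
    dist (insertCoord j c s) (insertCoord j c t) ≤ n * dist s t := by
  refine dist_le_mul_of_forall_coord (fun i => ?_) dist_nonneg
  by_cases h : i = j
  · subst h
    simp [insertCoord_self]
  · rw [insertCoord_of_ne _ h, insertCoord_of_ne _ h, ← Real.dist_eq]
    exact dist_le_pi_dist s t ⟨i, h⟩

theorem card_ne_fin (j : Fin n) : Fintype.card {i // i ≠ j} = n - 1 := by
  simp

theorem hausdorffMeasure_image_boxSide_ne_top (hΛ : 0 ≤ Λ)
    (hL : ∀ x ∈ boxSide a b j c, ∀ y ∈ boxSide a b j c, dist (Φ x) (Φ y) ≤ Λ * dist x y) :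
    μH[((n - 1 : ℕ) : ℝ)] (Φ '' boxSide a b j c) ≠ ⊤ := by
  set Q : Set ({i // i ≠ j} → ℝ) := univ.pi fun i => Ioo (a i) (b i) with hQ
  have hQmem : ∀ t ∈ Q, insertCoord j c t ∈ boxSide a b j c := fun t ht =>
    ⟨insertCoord_self t, fun i hi => by
      rw [insertCoord_of_ne t hi]; exact ht ⟨i, hi⟩ (mem_univ _)⟩
  have hGL : LipschitzOnWith (Λ * n).toNNReal (fun t => Φ (insertCoord j c t)) Q := by
    refine LipschitzOnWith.of_dist_le_mul fun s hs t ht => ?_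
    rw [Real.coe_toNNReal _ (by positivity), mul_assoc]
    exact (hL _ (hQmem s hs) _ (hQmem t ht)).trans
      (mul_le_mul_of_nonneg_left (dist_insertCoord_le s t) hΛ)
  have hsub : Φ '' boxSide a b j c ⊆ (fun t => Φ (insertCoord j c t)) '' Q := by
    rintro _ ⟨p, hp, rfl⟩
    refine ⟨fun i => p i, fun i _ => hp.2 i i.2, ?_⟩
    refine congrArg Φ ?_
    ext i
    by_cases h : i = j
    · subst h
      rw [insertCoord_self, hp.1]
    · rw [insertCoord_of_ne _ h]
  have hvol := hGL.hausdorffMeasure_image_le (d := (Fintype.card {i // i ≠ j} : ℝ)) (by positivity)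
  rw [hausdorffMeasure_pi_real, hQ, Real.volume_pi_Ioo, card_ne_fin, ENNReal.rpow_natCast] at hvol
  refine ne_top_of_le_ne_top ?_ ((measure_mono hsub).trans hvol)
  exact ENNReal.mul_ne_top (ENNReal.pow_ne_top ENNReal.coe_ne_top)
    (ENNReal.prod_ne_top fun _ _ => ENNReal.ofReal_ne_top)

/-- The inverse of `Φ` on the face, followed by the projection to the `n - 1` free coordinates, is
`Λ`-Lipschitz, and its image of the ball contains a box of known volume. The measure before
projection is thus at least that volume divided by `Λ ^ (n - 1)`. -/
theorem le_hausdorffMeasure_image_boxSide_inter_ball {κ l : ℝ} (hn : 0 < n) (hΛ : 1 ≤ Λ)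
    (hκ : 0 < κ) (hκ1 : κ ≤ 1) (hw : ∀ i, κ * l ≤ b i - a i)
    (hL : ∀ x ∈ boxSide a b j c, ∀ y ∈ boxSide a b j c, dist (Φ x) (Φ y) ≤ Λ * dist x y)
    (hA : ∀ x ∈ boxSide a b j c, ∀ y ∈ boxSide a b j c, dist x y ≤ Λ * dist (Φ x) (Φ y))
    {p : E n} (hp : p ∈ boxSide a b j c) {ρ : ℝ} (hρ : 0 < ρ) (hρl : ρ ≤ l) :
    ENNReal.ofReal ((κ / (2 * Λ ^ 2 * n)) ^ (n - 1) * ρ ^ (n - 1)) ≤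
      μH[((n - 1 : ℕ) : ℝ)] (Φ '' boxSide a b j c ∩ Metric.ball (Φ p) ρ) := by
  have hn' : (1 : ℝ) ≤ n := by exact_mod_cast hn
  have hΛ0 : 0 < Λ := by linarith
  set B := boxSide a b j c with hB
  set F := Φ '' B with hF
  have hinv : ∀ q ∈ B, Function.invFunOn Φ B (Φ q) = q := by
    have hinj : InjOn Φ B := fun x hx y hy hxy => by
      have := hA x hx y hy
      rw [hxy, dist_self, mul_zero] at this
      exact dist_le_zero.1 this
    exact fun q hq => hinj.leftInvOn_invFunOn hq
  set g : E n → {i // i ≠ j} → ℝ := fun y i => Function.invFunOn Φ B y i with hg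
  have hgL : LipschitzOnWith Λ.toNNReal g (F ∩ Metric.ball (Φ p) ρ) := by
    refine LipschitzOnWith.of_dist_le_mul ?_
    rintro _ ⟨⟨x, hx, rfl⟩, _⟩ _ ⟨⟨y, hy, rfl⟩, _⟩
    rw [Real.coe_toNNReal _ hΛ0.le]
    have h1 := (lipschitzWith_coord (fun i : {i // i ≠ j} => (i : Fin n))).dist_le_mul x y
    simp only [hg, hinv x hx, hinv y hy]
    rw [NNReal.coe_one, one_mul] at h1
    exact h1.trans (hA x hx y hy)
  -- With this choice `Φ` maps the points of the side within `n * s` of `p` to within `ρ / 2` of `Φ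
  -- p`.
  set s : ℝ := ρ / (2 * Λ * n) with hs
  have hs0 : 0 < s := by positivity
  have hsl : s ≤ l := by
    refine (div_le_self hρ.le ?_).trans hρl
    have := one_le_mul_of_one_le_of_one_le hΛ hn'
    nlinarith
  set T : Set ({i // i ≠ j} → ℝ) :=
    univ.pi fun i => Ioo (max (a i) (p i - s)) (min (b i) (p i + s)) with hT
  have hTsub : T ⊆ g '' (F ∩ Metric.ball (Φ p) ρ) := by
    intro t ht
    have hmem : insertCoord j c t ∈ B := by
      refine ⟨insertCoord_self t, fun i hi => ?_⟩
      have := ht ⟨i, hi⟩ (mem_univ _)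
      rw [insertCoord_of_ne t hi]
      exact ⟨(le_max_left _ _).trans_lt this.1, this.2.trans_le (min_le_left _ _)⟩
    have hd : dist (insertCoord j c t) p ≤ n * s := by
      refine dist_le_mul_of_forall_coord (fun i => ?_) hs0.le
      by_cases h : i = j
      · subst h
        rw [insertCoord_self, hp.1, sub_self, abs_zero]
        exact hs0.le
      · have := ht ⟨i, h⟩ (mem_univ _)
        rw [insertCoord_of_ne _ h, abs_le]
        have h1 := (le_max_right _ _).trans_lt this.1
        have h2 := this.2.trans_le (min_le_right _ _)
        constructor <;> linarith
    refine ⟨Φ (insertCoord j c t), ⟨mem_image_of_mem _ hmem, ?_⟩, ?_⟩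
    · rw [Metric.mem_ball]
      calc _ ≤ Λ * dist (insertCoord j c t) p := hL _ hmem _ hp
        _ ≤ Λ * (n * s) := by gcongr
        _ = ρ / 2 := by rw [hs]; field_simp
        _ < ρ := by linarith
    · funext i
      simp only [hg, hinv _ hmem]
      exact insertCoord_of_ne t i.2
  have hvol := hgL.hausdorffMeasure_image_le (d := (Fintype.card {i // i ≠ j} : ℝ)) (by positivity)
  rw [hausdorffMeasure_pi_real, card_ne_fin, ENNReal.rpow_natCast] at hvol
  have h := (measure_mono (μ := volume) hTsub).trans hvol
  have hlow : ENNReal.ofReal (κ * s) ^ (n - 1) ≤ volume T := by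
    rw [hT, Real.volume_pi_Ioo, ← card_ne_fin j, ← Finset.card_univ, ← Finset.prod_const]
    refine Finset.prod_le_prod' fun i _ => ENNReal.ofReal_le_ofReal ?_
    have h1 := hp.2 i i.2
    have h2 := hw i
    have h3 : κ * s ≤ κ * l := by gcongr
    have h4 : κ * s ≤ s := by nlinarith
    rw [mem_Ioo] at h1
    -- An interval cut off at most at one end keeps length `s`; cut off at both ends, it is a whole
    -- edge of the cell.
    rcases le_total (a i) (p i - s) with h5 | h5 <;> rcases le_total (b i) (p i + s) with h6 | h6 <;>
      simp only [h5, h6, max_eq_left, max_eq_right, min_eq_left, min_eq_right] <;> linarith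
  have h5 := hlow.trans h
  change _ ≤ ENNReal.ofReal Λ ^ (n - 1) * _ at h5
  have h6 : ENNReal.ofReal ((κ / (2 * Λ ^ 2 * n)) ^ (n - 1) * ρ ^ (n - 1)) =
      (ENNReal.ofReal Λ ^ (n - 1))⁻¹ * ENNReal.ofReal (κ * s) ^ (n - 1) := by
    rw [← ENNReal.ofReal_pow hΛ0.le, ← ENNReal.ofReal_inv_of_pos (by positivity),
      ← ENNReal.ofReal_pow (by positivity), ← ENNReal.ofReal_mul (by positivity), ← inv_pow,
      ← mul_pow, ← mul_pow, hs]
    congr 2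
    field_simp
  rw [h6]
  refine (mul_le_mul_right h5 _).trans (le_of_eq ?_)
  rw [← mul_assoc, ENNReal.inv_mul_cancel (by simp [hΛ0]) (ENNReal.pow_ne_top ENNReal.ofReal_ne_top),
    one_mul]

end Face

/-- The geometry of the faces of a shape regular hierarchical mesh: up to constants which depend
only on the dimension, on `Λ` and on `σ`, a face has size `l` and is lower Ahlfors regular below
that scale. -/
theorem exists_face_constants (e : ℕ) (Λ σ : ℝ) :
    ∃ c > 0, ∃ A > 0, ∀ (M : Hierarchy (e + 2)) (Φ : E (e + 2) → E (e + 2)),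
      IsRegularParam M Λ Φ → IsShapeRegular σ (M.mesh Φ) → ∀ F ∈ M.faces Φ,
      MeasurableSet F ∧ IsFiniteMeasure (surf F) ∧
      ∃ l, 0 < l ∧ l ≤ 1 ∧ 0 < pathDiam F ∧ pathDiam F ≤ A * l ∧
        ∀ x ∈ F, ∀ ρ, 0 < ρ → ρ ≤ l →
          ENNReal.ofReal (c * ρ ^ (e + 1)) ≤ surf F (Metric.ball x ρ) := by
  set n := e + 2 with hn
  have hn0 : 0 < n := by omega
  have hn' : (0 : ℝ) < n := by exact_mod_cast hn0
  -- Raising both constants to at least `1` preserves the hypotheses and settles all signs.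
  set L := max Λ 1 with hLdef
  set τ := max σ 1 with hτdef
  have hL1 : 1 ≤ L := le_max_right _ _
  have hτ1 : 1 ≤ τ := le_max_right _ _
  have hL0 : 0 < L := by linarith
  have hτ0 : 0 < τ := by linarith
  set f := Measure.addHaarScalarFactor (volume : Measure (EuclideanSpace ℝ (Fin (n - 1))))
    μH[((n - 1 : ℕ) : ℝ)] with hf
  have hf0 : 0 < f :=
    pos_iff_ne_zero.2 (Measure.addHaarScalarFactor_volume_hausdorffMeasure_ne_zero (n - 1))
  set κ := widthRatio n L τ with hκdef
  have hκ : 0 < κ := widthRatio_pos hn0 hL0 hτ0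
  have hκ1 : κ ≤ 1 := widthRatio_le_one hn0 hL1 hτ1
  refine ⟨f * (κ / (2 * L ^ 2 * n)) ^ (n - 1), by positivity, L * n, by positivity, ?_⟩
  intro M Φ hΦ hsr F hF
  obtain ⟨a, b, hact, j, c, hc, rfl⟩ := hF
  have hbd := hact.bounds
  have hab : ∀ i, a i < b i := fun i => (hbd i).2.1
  have hK : openBox a b ∈ M.parametricMesh := ⟨a, b, hact, rfl⟩
  have hcube : closure (openBox a b) ⊆ closedCube n := by
    rw [closure_openBox hab]
    exact fun x hx i => ⟨(hbd i).1.trans (hx i).1, (hx i).2.trans (hbd i).2.2⟩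
  have hLip : ∀ x ∈ closure (openBox a b), ∀ y ∈ closure (openBox a b),
      dist (Φ x) (Φ y) ≤ L * dist x y := fun x hx y hy =>
    (hΦ.le_mul_dist x (hcube hx) y (hcube hy)).trans
      (mul_le_mul_of_nonneg_right (le_max_left _ _) dist_nonneg)
  have hAnti : ∀ x ∈ closure (openBox a b), ∀ y ∈ closure (openBox a b),
      dist x y ≤ L * dist (Φ x) (Φ y) := fun x hx y hy =>
    (hΦ.dist_le_mul x (hcube hx) y (hcube hy)).trans
      (mul_le_mul_of_nonneg_right (le_max_left _ _) dist_nonneg)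
  have hside := boxSide_subset_closure hab hc
  have hLs : ∀ x ∈ boxSide a b j c, ∀ y ∈ boxSide a b j c, dist (Φ x) (Φ y) ≤ L * dist x y :=
    fun x hx y hy => hLip x (hside hx) y (hside hy)
  have hAs : ∀ x ∈ boxSide a b j c, ∀ y ∈ boxSide a b j c, dist x y ≤ L * dist (Φ x) (Φ y) :=
    fun x hx y hy => hAnti x (hside hx) y (hside hy)
  have hcont : ContinuousOn Φ (boxSide a b j c) :=
    (LipschitzOnWith.of_dist_le_mul (K := L.toNNReal) fun x hx y hy => by
      rw [Real.coe_toNNReal _ hL0.le]; exact hLs x hx y hy).continuousOn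
  have hinj : InjOn Φ (boxSide a b j c) := fun x hx y hy hxy => by
    have := hAs x hx y hy
    rw [hxy, dist_self, mul_zero] at this
    exact dist_le_zero.1 this
  -- Lusin–Souslin: an injective continuous image of a Borel set is Borel.
  have hFm : MeasurableSet (Φ '' boxSide a b j c) :=
    measurableSet_boxSide.image_of_continuousOn_injOn hcont hinj
  have hsurf : ∀ s, (μHE[n - 1] : Measure (E n)) s = f * μH[((n - 1 : ℕ) : ℝ)] s := fun s => rfl
  obtain ⟨i₀, -, hi₀⟩ := Finset.exists_max_image Finset.univ (fun i => b i - a i)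
    ⟨j, Finset.mem_univ j⟩
  set l := b i₀ - a i₀ with hl
  have hl0 : 0 < l := sub_pos.2 (hab i₀)
  have hw : ∀ i, b i - a i ≤ l := fun i => hi₀ i (Finset.mem_univ i)
  have hdist : ∀ x ∈ boxSide a b j c, ∀ y ∈ boxSide a b j c, dist x y ≤ n * l :=
    fun x hx y hy => dist_le_of_mem_closure_openBox hab hl0.le hw (hside hx) (hside hy)
  have hshape : pathDiam (Φ '' openBox a b) ≤ τ * inradius (Φ '' openBox a b) := by
    refine (hsr _ ⟨_, hK, rfl⟩).trans (mul_le_mul_of_nonneg_right (le_max_left _ _) ?_)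
    refine Real.sSup_nonneg' ⟨0, ⟨0, by simp⟩, le_rfl⟩
  have hwidth : ∀ i, κ * l ≤ b i - a i :=
    widthRatio_mul_le hn0 hab hL0 hτ0
      (fun x hx y hy => hLip x (subset_closure hx) y (subset_closure hy))
      (fun x hx y hy => hAnti x (subset_closure hx) y (subset_closure hy))
      (hΦ.smooth _ hK) hshape i₀ rfl hw
  refine ⟨hFm, ⟨?_⟩, l, hl0, ?_, ?_, ?_, ?_⟩
  · rw [surf, Measure.restrict_apply_univ, hsurf]
    exact ENNReal.mul_lt_top ENNReal.coe_lt_top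
      (hausdorffMeasure_image_boxSide_ne_top hL0.le hLs).lt_top
  · linarith [(hbd i₀).1, (hbd i₀).2.2]
  -- As `n ≥ 2`, the side has a free direction and so two distinct points; the inverse of its
  -- diameter is then a genuine inverse.
  · obtain ⟨i, hi⟩ : ∃ i : Fin n, i ≠ j := exists_ne j
    set p : ℝ → E n := fun s => insertCoord j c fun i => a i + s * (b i - a i) with hp
    have hpm : ∀ s ∈ Ioo (0 : ℝ) 1, p s ∈ boxSide a b j c := by
      refine fun s hs => ⟨insertCoord_self _, fun k hk => ?_⟩
      have := sub_pos.2 (hab k)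
      rw [hp, insertCoord_of_ne _ hk]
      simp only [mem_Ioo]
      constructor <;> nlinarith [hs.1, hs.2]
    have h := dist_le_mul_pathDiam_image convex_boxSide hside (hΦ.smooth _ hK) hL0.le hLs hAs hdist
      (hpm (3 / 4) (by norm_num)) (hpm (1 / 4) (by norm_num))
    have hpos : 0 < dist (p (3 / 4)) (p (1 / 4)) := by
      rw [dist_pos]
      intro heq
      have h1 : p (3 / 4) i = p (1 / 4) i := by rw [heq]
      simp only [hp, insertCoord_of_ne _ hi] at h1
      linarith [hab i]
    exact pos_of_mul_pos_right (hpos.trans_le h) hL0.le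
  · rw [mul_assoc]
    exact pathDiam_image_le convex_boxSide hside (hΦ.smooth _ hK) hL0.le hLs (by positivity) hdist
  · rintro _ ⟨p, hp, rfl⟩ ρ hρ hρl
    have h := le_hausdorffMeasure_image_boxSide_inter_ball hn0 hL1 hκ hκ1 hwidth hLs hAs hp hρ hρl
    rw [surf, Measure.restrict_apply Metric.isOpen_ball.measurableSet, hsurf, inter_comm, mul_assoc,
      ENNReal.ofReal_mul (by positivity), ENNReal.ofReal_coe_nnreal]
    exact mul_le_mul_right h _

/-! ### The weights -/

theorem eta_pos : 0 < eta := existsUnique_eta.choose_spec.1.1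

/-- Take `N = ⌈log₂ (1 / s)⌉`, read as `0` for `s ≥ 1`. Then `l / 2 ^ N ≤ s`, and `N` is at most `2
m + 1` because `1 / log 2 < 2`. -/
theorem exists_dyadic_sum_le_log {s l : ℝ} (hs : 0 < s) (hl1 : l ≤ 1) :
    ∃ N : ℕ, l / 2 ^ N + s * (N + 1) ≤ (3 / eta + 2) * (max (-Real.log s) eta * s) := by
  set m := max (-Real.log s) eta with hm
  have hη := eta_pos
  have hmη : eta ≤ m := le_max_right _ _
  have hlog2 : 1 / 2 < Real.log 2 := by linarith [Real.log_two_gt_d9]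
  set t := -Real.log s / Real.log 2 with ht
  have htm : t ≤ 2 * m := by
    rw [ht, div_le_iff₀ (by linarith)]
    have : -Real.log s ≤ m := le_max_left _ _
    nlinarith
  have hN : (⌈t⌉₊ : ℝ) ≤ 2 * m + 1 := by
    rcases le_total t 0 with h | h
    · rw [Nat.ceil_eq_zero.2 h]
      push_cast
      linarith
    · linarith [Nat.ceil_lt_add_one h]
  have hpow : l / 2 ^ ⌈t⌉₊ ≤ s := by
    rw [div_le_iff₀ (by positivity), ← div_le_iff₀' hs]
    have h1 : 1 / s = (2 : ℝ) ^ t := by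
      rw [ht, Real.rpow_def_of_pos (by norm_num), mul_div_cancel₀ _ (by linarith), Real.exp_neg,
        Real.exp_log hs, one_div]
    calc l / s ≤ 1 / s := by gcongr
      _ = (2 : ℝ) ^ t := h1
      _ ≤ (2 : ℝ) ^ ((⌈t⌉₊ : ℕ) : ℝ) := Real.rpow_le_rpow_of_exponent_le (by norm_num) (Nat.le_ceil t)
      _ = _ := Real.rpow_natCast _ _
  refine ⟨⌈t⌉₊, ?_⟩
  -- The floor `eta` in the weight absorbs the additive constant when the logarithm is small or
  -- negative.
  have h3 : 3 ≤ 3 / eta * m := by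
    rw [div_mul_eq_mul_div, le_div_iff₀ hη]
    linarith
  calc _ ≤ s + s * (2 * m + 1 + 1) := by gcongr
    _ = s * (2 * m + 3) := by ring
    _ ≤ s * (2 * m + 3 / eta * m) := by gcongr
    _ = _ := by ring

/-- Choose `2 ^ N ≤ l / √s < 2 ^ (N + 1)`, which balances the two terms. The summand `1 / l`
completes the geometric sum to exactly `2 ^ N / l`. -/
theorem exists_dyadic_sum_le_sqrt {s l : ℝ} (hs : 0 < s) (hl : 0 < l) (hsl : s ≤ l ^ 2) :
    ∃ N : ℕ, l / 2 ^ N + s * (∑ k ∈ Finset.range N, 2 ^ k / l + 1 / l) ≤ 3 * √s := by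
  have hq : 0 < √s := Real.sqrt_pos.2 hs
  have hql : √s ≤ l := Real.sqrt_le_iff.2 ⟨hl.le, hsl⟩
  obtain ⟨N, h1, h2⟩ := exists_nat_pow_near ((one_le_div hq).2 hql) (one_lt_two (α := ℝ))
  have hsum : ∑ k ∈ Finset.range N, (2 : ℝ) ^ k / l + 1 / l = 2 ^ N / l := by
    rw [← Finset.sum_div, geom_sum_eq (by norm_num)]
    ring
  refine ⟨N, ?_⟩
  rw [hsum]
  have h3 : l / 2 ^ N ≤ 2 * √s := by
    rw [pow_succ, div_lt_iff₀ hq] at h2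
    rw [div_le_iff₀ (by positivity)]
    linarith
  have h4 : s * (2 ^ N / l) ≤ √s := by
    rw [le_div_iff₀ hq] at h1
    rw [← mul_div_assoc, div_le_iff₀ hl]
    calc s * 2 ^ N = √s * (2 ^ N * √s) := by nth_rewrite 1 [← Real.mul_self_sqrt hs.le]; ring
      _ ≤ √s * l := by gcongr
  linarith

theorem exists_weight_constant (e : ℕ) (he : e = 0 ∨ e = 1) :
    ∃ C > 0, ∀ (S : Set (E (e + 2))) (l : ℝ), 0 < area S → 0 < l → l ≤ 1 →
      (∃ N : ℕ, l / 2 ^ N + area S * (∑ k ∈ Finset.range N, (2 ^ k / l) ^ e + 1 / l ^ e) ≤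
        C * (logConst S * area S ^ (1 / (2 * (((e + 2 : ℕ) : ℝ) - 1)))) ^ 2) ∨
      l ≤ C * (logConst S * area S ^ (1 / (2 * (((e + 2 : ℕ) : ℝ) - 1)))) ^ 2 := by
  have hη := eta_pos
  rcases he with rfl | rfl
  · refine ⟨3 / eta + 2, by positivity, fun S l hs hl hl1 => Or.inl ?_⟩
    obtain ⟨N, hN⟩ := exists_dyadic_sum_le_log hs hl1
    refine ⟨N, ?_⟩
    have hw : (logConst S * area S ^ (1 / (2 * (((0 + 2 : ℕ) : ℝ) - 1)))) ^ 2 =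
        max (-Real.log (area S)) eta * area S := by
      rw [mul_pow, logConst, if_pos rfl, Real.sq_sqrt (hη.le.trans (le_max_right _ _)),
        ← Real.rpow_natCast, ← Real.rpow_mul hs.le]
      norm_num
    rw [hw]
    simpa using hN
  · refine ⟨3, by norm_num, fun S l hs hl hl1 => ?_⟩
    have hw : (logConst S * area S ^ (1 / (2 * (((1 + 2 : ℕ) : ℝ) - 1)))) ^ 2 = √(area S) := by
      rw [mul_pow, logConst, if_neg (by norm_num), ← Real.rpow_natCast, ← Real.rpow_natCast,
        ← Real.rpow_mul hs.le, Real.sqrt_eq_rpow]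
      norm_num
    rw [hw]
    rcases le_total (area S) (l ^ 2) with h | h
    · obtain ⟨N, hN⟩ := exists_dyadic_sum_le_sqrt hs hl h
      exact Or.inl ⟨N, by simpa using hN⟩
    · refine Or.inr ?_
      have h1 : l ≤ √(area S) := Real.le_sqrt_of_sq_le h
      linarith

/-! ### The estimate on a part of a face -/

theorem normL2_nonneg {n : ℕ} (v : E n → ℝ) (S : Set (E n)) : 0 ≤ normL2 v S :=
  ENNReal.toReal_nonneg

theorem area_nonneg {n : ℕ} (S : Set (E n)) : 0 ≤ area S := ENNReal.toReal_nonneg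

theorem lintegral_enorm_sq_eq {n : ℕ} {v : E n → ℝ} {S : Set (E n)}
    (h : eLpNorm v 2 (surf S) ≠ ⊤) :
    ∫⁻ x, ‖v x‖ₑ ^ 2 ∂surf S = ENNReal.ofReal (normL2 v S ^ 2) := by
  rw [normL2, ← ENNReal.toReal_pow, ENNReal.ofReal_toReal (ENNReal.pow_ne_top h)]
  simpa using (eLpNorm_nnreal_pow_eq_lintegral (μ := surf S) (f := v) (p := 2) (by norm_num)).symm

/-- The bound `V ≤ A * l * R` turns `V / l ^ (e + 1)` into a multiple of `R / l ^ e`, the source of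
the last term of the bracket. -/
theorem dyadic_bound_le {c A l r s T q V W R : ℝ} {e : ℕ} (hc : 0 < c) (hA : 0 < A) (hl : 0 < l)
    (hr : 0 ≤ r) (hs : 0 ≤ s) (hT : 0 ≤ T) (hq : 0 ≤ q) (hR : 0 ≤ R) (hVR : V ≤ A * l * R)
    (hWR : W ≤ R) :
    2 / c * r * W + 4 * (T * (q / c ^ 2 * W) + V / (c * l ^ (e + 1))) * s ≤
      (2 / c + 4 * (q / c ^ 2) + 4 * A / c) * (r + s * (T + 1 / l ^ e)) * R := by
  have h1 : V / (c * l ^ (e + 1)) ≤ A / c * (1 / l ^ e) * R := by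
    rw [div_le_iff₀ (by positivity)]
    refine hVR.trans (le_of_eq ?_)
    field_simp
    ring
  have k1 : 0 ≤ 2 / c := by positivity
  have k2 : 0 ≤ 4 * (q / c ^ 2) := by positivity
  have k3 : 0 ≤ 4 * A / c := by positivity
  have k4 : 0 ≤ 1 / l ^ e := by positivity
  set K : ℝ := 2 / c + 4 * (q / c ^ 2) + 4 * A / c with hK
  calc _ ≤ 2 / c * r * R + 4 * (T * (q / c ^ 2 * R) + A / c * (1 / l ^ e) * R) * s := by gcongr
    _ = (2 / c * r + 4 * (q / c ^ 2) * (s * T) + 4 * A / c * (s * (1 / l ^ e))) * R := by ring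
    _ ≤ (K * r + K * (s * T) + K * (s * (1 / l ^ e))) * R := by
        gcongr <;> linarith
    _ = _ := by ring

theorem exists_normL2_sq_le (e : ℕ) (he : e = 0 ∨ e = 1) {c A : ℝ} (hc : 0 < c) (hA : 0 < A) :
    ∃ C > 0, ∀ (F S : Set (E (e + 2))) (l h : ℝ) (v : E (e + 2) → ℝ), MeasurableSet S → S ⊆ F →
      IsFiniteMeasure (surf F) → 0 < l → l ≤ 1 → 0 < h → h ≤ A * l →
      (∀ x ∈ F, ∀ ρ, 0 < ρ → ρ ≤ l →
        ENNReal.ofReal (c * ρ ^ (e + 1)) ≤ surf F (Metric.ball x ρ)) →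
      MemHHalf v F →
      normL2 v S ^ 2 ≤ C * (logConst S * area S ^ (1 / (2 * (((e + 2 : ℕ) : ℝ) - 1)))) ^ 2 *
        (h⁻¹ * normL2 v F ^ 2 + seminormHalf v F ^ 2) := by
  obtain ⟨D, hD, hweight⟩ := exists_weight_constant e he
  set K : ℝ := 2 / c + 4 * (2 ^ (2 * e + 4) / c ^ 2) + 4 * A / c with hK
  have hK0 : 0 < K := by positivity
  refine ⟨K * D + A * D, by positivity, ?_⟩
  intro F S l h v hS hSF hfin hl hl1 hh hhl hball hv
  have hmono : surf S ≤ surf F := Measure.restrict_mono hSF le_rfl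
  set V := normL2 v F ^ 2 with hV
  set W := seminormHalf v F ^ 2 with hW
  set w := (logConst S * area S ^ (1 / (2 * (((e + 2 : ℕ) : ℝ) - 1)))) ^ 2 with hw
  have hV0 : 0 ≤ V := sq_nonneg _
  have hW0 : 0 ≤ W := sq_nonneg _
  have hw0 : 0 ≤ w := sq_nonneg _
  set R := h⁻¹ * V + W with hR
  have hR0 : 0 ≤ R := by positivity
  have hVR : V ≤ A * l * R := by
    have h1 : h * R = V + h * W := by rw [hR]; field_simp
    nlinarith [mul_le_mul_of_nonneg_right hhl hR0, mul_nonneg hh.le hW0]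
  have hWR : W ≤ R := by
    have : 0 ≤ h⁻¹ * V := by positivity
    linarith
  have hvF := hv.1.eLpNorm_ne_top
  have hvS : eLpNorm v 2 (surf S) ≠ ⊤ := ne_top_of_le_ne_top hvF (eLpNorm_mono_measure v hmono)
  have hSV : normL2 v S ^ 2 ≤ V :=
    pow_le_pow_left₀ (normL2_nonneg v S)
      (ENNReal.toReal_mono hvF (eLpNorm_mono_measure v hmono)) 2
  have hsub : (surf F).restrict S = surf S := by
    rw [surf, Measure.restrict_restrict hS, inter_eq_left.2 hSF, surf]
  have hμS : (surf F S).toReal = area S := by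
    rw [surf, Measure.restrict_apply hS, inter_eq_left.2 hSF, area]
  -- A null part is treated apart, since the choice of `N` needs positive area.
  rcases (area_nonneg S).eq_or_lt with h0 | hpos
  · have : surf S = 0 := by
      rw [← hsub, Measure.restrict_eq_zero]
      exact ((ENNReal.toReal_eq_zero_iff _).1 (hμS.trans h0.symm)).resolve_right
        (measure_ne_top _ _)
    have : normL2 v S = 0 := by simp [normL2, this]
    rw [this, zero_pow two_ne_zero]
    positivity
  have hvW : ∫⁻ y, ∫⁻ z, edist (v y) (v z) ^ 2 / edist y z ^ (e + 2) ∂surf F ∂surf F ≤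
      ENNReal.ofReal W := by
    rw [hW, seminormHalf, Real.sq_sqrt ENNReal.toReal_nonneg, ENNReal.ofReal_toReal hv.2]
    rfl
  rcases hweight S l hpos hl hl1 with ⟨N, hN⟩ | hlw
  · have hint := setLIntegral_sq_le_of_ball hS (hv.1.integrable (by norm_num)) hc hl hV0 hW0
      (fun x hx => hball x (hSF hx)) (lintegral_enorm_sq_eq hvF).le hvW N
    set T : ℝ := ∑ k ∈ Finset.range N, ((2 : ℝ) ^ k / l) ^ e
    have hT0 : 0 ≤ T := Finset.sum_nonneg fun _ _ => by positivity
    have hs0 := area_nonneg S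
    rw [hsub, lintegral_enorm_sq_eq hvS, hμS] at hint
    rw [← hw] at hN
    clear_value V W w R T K
    rw [ENNReal.ofReal_le_ofReal_iff (by positivity)] at hint
    have hB : normL2 v S ^ 2 ≤ K * (l / 2 ^ N + area S * (T + 1 / l ^ e)) * R :=
      hK ▸ hint.trans (dyadic_bound_le hc hA hl (by positivity) hs0 hT0 (by positivity)
        hR0 hVR hWR)
    calc _ ≤ _ := hB
      _ ≤ K * (D * w) * R := by gcongr
      _ = K * D * w * R := by ring
      _ ≤ (K * D + A * D) * w * R := by
          have : 0 ≤ A * D := by positivity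
          gcongr
          linarith
  · calc _ ≤ V := hSV
      _ ≤ A * l * R := hVR
      _ ≤ A * (D * w) * R := by gcongr
      _ = A * D * w * R := by ring
      _ ≤ (K * D + A * D) * w * R := by
          have : 0 ≤ K * D := by positivity
          gcongr
          linarith

end TrimmedIGA

open TrimmedIGA
theorem lemma5p2 (n : ℕ) (hn : n = 2 ∨ n = 3) (Λ σ : ℝ) :
    ∃ C : ℝ, 0 < C ∧
      ∀ (M : Hierarchy n) (Φ : E n → E n),
        IsRegularParam M Λ Φ → IsShapeRegular σ (M.mesh Φ) →
      ∀ (s : ℕ) (D : Fin s → Set (E n)),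
        (∀ i, IsOpen (D i) ∧ IsConnected (D i) ∧ Bornology.IsBounded (D i)) →
      ∀ ΓN : Set (E n), IsOpenInBoundary (trimmedDomain Φ D) ΓN →
      ∀ F ∈ cutFaces (M.faces Φ) ΓN, (F ∩ ΓN).Nonempty →
      ∀ v : E n → ℝ, MemHHalf v F →
        normL2 v (F ∩ ΓN) ≤
          C * (logConst (F ∩ ΓN) * area (F ∩ ΓN) ^ (1 / (2 * ((n : ℝ) - 1)))) *
            √((pathDiam F)⁻¹ * normL2 v F ^ 2 + seminormHalf v F ^ 2) ∧
        logConst (F ∩ ΓN) * area (F ∩ ΓN) ^ (1 / (2 * ((n : ℝ) - 1))) = delta ΓN F := by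
  -- With `n = e + 2`, the face has dimension `e + 1` and the kernel exponent `e + 2`.
  obtain ⟨e, he, rfl⟩ : ∃ e, (e = 0 ∨ e = 1) ∧ n = e + 2 := ⟨n - 2, by omega, by omega⟩
  obtain ⟨c, hc, A, hA, hface⟩ := exists_face_constants e Λ σ
  obtain ⟨C, hC, hest⟩ := exists_normL2_sq_le e he hc hA
  refine ⟨√C, Real.sqrt_pos.2 hC, ?_⟩
  intro M Φ hΦ hsr s D _ ΓN hΓ F hF _ v hv
  obtain ⟨hFm, hfin, l, hl, hl1, hd, hdl, hball⟩ := hface M Φ hΦ hsr F hF.1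
  obtain ⟨U, hU, rfl⟩ := hΓ
  set ΓN := U ∩ frontier (trimmedDomain Φ D)
  have hS : MeasurableSet (F ∩ ΓN) :=
    hFm.inter (hU.measurableSet.inter isClosed_frontier.measurableSet)
  refine ⟨?_, ?_⟩
  · have hw : 0 ≤ logConst (F ∩ ΓN) *
        area (F ∩ ΓN) ^ (1 / (2 * (((e + 2 : ℕ) : ℝ) - 1))) := by
      refine mul_nonneg ?_ (Real.rpow_nonneg (area_nonneg _) _)
      unfold logConst
      split_ifs <;> positivity
    have h := hest F (F ∩ ΓN) l (pathDiam F) v hS inter_subset_left hfin hl hl1 hd hdl hball hv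
    have h2 := Real.sqrt_le_sqrt h
    rwa [Real.sqrt_sq (normL2_nonneg _ _), Real.sqrt_mul (by positivity),
      Real.sqrt_mul hC.le, Real.sqrt_sq hw] at h2
  · rw [delta, if_neg fun h => hF.2 (inter_eq_left.2 h)]
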